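/- Let $F=\mathbb R$ or $F=\mathbb C$, let $d=\dim_{\mathbb R}F$, and let $n\ge 3$. Let $J$ be the $(n+2)\times(n+2)$ block matrix $\begin{pmatrix}0&0&P\\0&\mathrm{Id}_{n-2}&0\\P&0&0\end{pmatrix}$ with $P=\begin{pmatrix}0&1\\1&0\end{pmatrix}$, let $$G=\mathrm{SU}(2,n;F)=\{g\in \mathrm{SL}(n+2,F)\mid gJg^\dagger=J\},$$ and let $\mathfrak g=\{X\in\mathfrak{sl}(n+2,F)\mid XJ+JX^\dagger=0\}$. Let $A\subset G$ be the subgroup of diagonal matrices in $G$ with nonnegative real entries, and let $N\subset G$ be the subgroup of upper triangular matrices in $G$ with only $1$'s on the diagonal. For $a\in A$ put $\alpha(a)=a_{1,1}/a_{2,2}$ and $\beta(a)=a_{2,2}$, and for nonnegative integers $p,q$, not both zero, let $$\mathfrak n_{p\alpha+q\beta}=\{X\in\mathfrak g\mid aXa^{-1}=\alpha(a)^p\beta(a)^q X\text{ for all }a\in A\}.$$ For $u\in \mathfrak g$ write $\phi_u=u_{1,2}$, $x_u=(u_{1,3},\dots,u_{1,n})\in F^{n-2}$, $\eta_u=u_{1,n+1}$,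 and let $|x_u|$ be the Euclidean norm of $x_u$. For $h\in G$ let $\|h\|$ be the maximum absolute value of the entries of $h$, and let $\|\rho(h)\|$, where $\rho(h)=h\wedge h$, be the maximum absolute value of the $2\times2$ minors of $h$. Let $H$ be a closed, connected subgroup of $G$ that is contained in $AN$ and is compatible with $A$, that is, $H\subset T_0\,(H\cap N)\,C_N(T_0)$, where $T_0=A\cap(HN)$ and $C_N(T_0)$ is the centralizer of $T_0$ in $N$. Put $U=H\cap N$, and let $\mathfrak u$ be the Lie algebra of $U$. Suppose that there is no continuous curve $h^t$ in $H$ such that $\|h^t\|\to\infty$ as $t\to\infty$ and $\|\rho(h^t)\|\asymp\|h^t\|^2$ as $t\to\infty$ (each side is at most a constant multiple of the other for all large $t$). Then $$\dim H\le d\,n .$$ Furthermore, if $\dim H=d\,n$, then $H=T\ltimes U$ (an internal semidirect product in which $U$ is normal), where 1. $T=\ker\beta\subset A$; 2. $\mathfrak u=\bigl((\mathfrak n_\alpha+\mathfrak n_{\alpha+\beta}+\mathfrak n_{\alpha+2\beta})\cap\mathfrak u\bigr)+\mathfrak n_{2\alpha+2\beta}$; 3. $|x_u|^2+2\,\mathrm{Re}(\phi_u\overline{\eta_u})\ne0$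 for every $u\in\mathfrak u\smallsetminus\mathfrak n_{2\alpha+2\beta}$. -/

import Mathlib

open Matrix Filter
open scoped Pointwise

namespace SU2

/-- Square matrices of size `n + 2` over `F`. -/
abbrev Mat (n : ℕ) (F : Type*) [RCLike F] := Matrix (Fin (n + 2)) (Fin (n + 2)) F

/-- The group `SL(n+2,F)`. -/
abbrev SL (n : ℕ) (F : Type*) [RCLike F] := SpecialLinearGroup (Fin (n + 2)) F

variable {n : ℕ} {F : Type*} [RCLike F]

/-- The matrix `J` of size `n + 2`: ones on the antidiagonal in the first two and last two
rows, and the identity matrix in the middle `(n - 2) × (n - 2)` block. -/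
def formJ (n : ℕ) (F : Type*) [RCLike F] : Mat n F := fun i j =>
  if i.val < 2 ∨ n ≤ i.val then (if i.val + j.val = n + 1 then 1 else 0)
  else (if i = j then 1 else 0)

/-- The group `SU(2,n;F) = {g ∈ SL(n+2,F) | g J g† = J}`. -/
def G (n : ℕ) (F : Type*) [RCLike F] : Subgroup (SL n F) where
  carrier := {g : SL n F | (g : Mat n F) * formJ n F * (g : Mat n F)ᴴ = formJ n F}
  one_mem' := by simp
  mul_mem' := by
    intro a b ha hb
    simp only [Set.mem_ofPred_eq] at *
    change (a : Mat n F) * (b : Mat n F) * formJ n F * ((a : Mat n F) * (b : Mat n F))ᴴ = formJ n F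
    rw [conjTranspose_mul]
    calc (a : Mat n F) * b * formJ n F * ((b : Mat n F)ᴴ * (a : Mat n F)ᴴ)
        = a * (b * formJ n F * (b : Mat n F)ᴴ) * (a : Mat n F)ᴴ := by
          simp only [Matrix.mul_assoc]
      _ = formJ n F := by rw [hb, ha]
  inv_mem' := by
    intro a ha
    simp only [Set.mem_ofPred_eq] at *
    have h1 : ((a⁻¹ : SL n F) : Mat n F) * a = 1 := congrArg Subtype.val (inv_mul_cancel a)
    have h2 : (a : Mat n F)ᴴ *
        ((a⁻¹ : SL n F) : Mat n F)ᴴ = 1 := by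
      rw [← conjTranspose_mul, h1, conjTranspose_one]
    generalize ((a⁻¹ : SL n F) : Mat n F) = b at *
    calc b * formJ n F * bᴴ
        = b * ((a : Mat n F) * formJ n F * (a : Mat n F)ᴴ) * bᴴ := by rw [ha]
      _ = (b * a) * formJ n F * ((a : Mat n F)ᴴ * bᴴ) := by simp only [Matrix.mul_assoc]
      _ = formJ n F := by rw [h1, h2, Matrix.one_mul, Matrix.mul_one]

/-- `A`: the diagonal matrices in `SU(2,n;F)` with nonnegative real entries. -/
def A (n : ℕ) (F : Type*) [RCLike F] : Subgroup (SL n F) where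
  carrier := {g : SL n F | g ∈ G n F ∧ ∃ d : Fin (n + 2) → ℝ, (∀ i, 0 ≤ d i) ∧
    (g : Mat n F) = diagonal (fun i => (d i : F))}
  one_mem' := ⟨one_mem _, fun _ => 1, by simp, by simp⟩
  mul_mem' := by
    rintro a b ⟨ha, d, hd, hda⟩ ⟨hb, e, he, heb⟩
    exact ⟨mul_mem ha hb, fun i => d i * e i, fun i => mul_nonneg (hd i) (he i), by
      change (a : Mat n F) * (b : Mat n F) = _
      rw [hda, heb, diagonal_mul_diagonal]; simp⟩
  inv_mem' := by
    rintro a ⟨ha, d, hd, hda⟩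
    refine ⟨inv_mem ha, fun i => ∏ j ∈ Finset.univ.erase i, d j,
      fun i => Finset.prod_nonneg fun j _ => hd j, ?_⟩
    change adjugate (a : Mat n F) = _
    rw [hda, adjugate_diagonal]
    simp

/-- `N`: the upper triangular matrices in `SU(2,n;F)` with only ones on the diagonal. -/
def N (n : ℕ) (F : Type*) [RCLike F] : Subgroup (SL n F) where
  carrier := {g : SL n F | g ∈ G n F ∧ (g : Mat n F).BlockTriangular id ∧
    ∀ i, (g : Mat n F) i i = 1}
  one_mem' := ⟨one_mem _, by simpa using blockTriangular_one, by simp⟩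
  mul_mem' := by
    rintro a b ⟨ha, ta, da⟩ ⟨hb, tb, db⟩
    refine ⟨mul_mem ha hb, by simpa using ta.mul tb, fun i => ?_⟩
    change ((a : Mat n F) * (b : Mat n F)) i i = 1
    rw [Matrix.mul_apply, Finset.sum_eq_single i]
    · rw [da, db, one_mul]
    · intro j _ hj
      rcases lt_or_gt_of_ne hj with h | h
      · rw [ta h, zero_mul]
      · rw [tb h, mul_zero]
    · simp
  inv_mem' := by
    rintro a ⟨ha, ta, da⟩
    have h1 : (a : Mat n F) *
        ((a⁻¹ : SL n F) : Mat n F) = 1 := congrArg Subtype.val (mul_inv_cancel a)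
    have h2 : ((a⁻¹ : SL n F) : Mat n F)
        = (a : Mat n F)⁻¹ := (Matrix.inv_eq_right_inv h1).symm
    have tb : ((a⁻¹ : SL n F) : Mat n F).BlockTriangular id := by
      have : Invertible (a : Mat n F) := ⟨_, mul_eq_one_comm.mp h1, h1⟩
      rw [h2]
      exact blockTriangular_inv_of_blockTriangular ta
    refine ⟨inv_mem ha, tb, fun i => ?_⟩
    have h3 := congrFun (congrFun h1 i) i
    rw [Matrix.mul_apply, Finset.sum_eq_single i, da, one_mul, Matrix.one_apply_eq] at h3
    · exact h3
    · intro j _ hj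
      rcases lt_or_gt_of_ne hj with h | h
      · rw [ta h, zero_mul]
      · rw [tb h, mul_zero]
    · simp

/-- The simple root `α(a) = a₁₁ / a₂₂` (as a multiplicative character of `A`). -/
def rootα (a : SL n F) : F :=
  (a : Mat n F) 0 0 / (a : Mat n F) 1 1

/-- The simple root `β(a) = a₂₂` (as a multiplicative character of `A`). -/
def rootβ (a : SL n F) : F := (a : Mat n F) 1 1

/-- The subgroup `ker β` of `A`. -/
def kerβ (n : ℕ) (F : Type*) [RCLike F] : Subgroup (SL n F) where
  carrier := {a : SL n F | a ∈ A n F ∧ rootβ a = 1}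
  one_mem' := ⟨one_mem _, by simp [rootβ]⟩
  mul_mem' := by
    rintro a b ⟨ha, h1⟩ ⟨hb, h2⟩
    refine ⟨mul_mem ha hb, ?_⟩
    obtain ⟨_, d, _, hd⟩ := ha
    obtain ⟨_, e, _, he⟩ := hb
    simp only [rootβ] at *
    rw [hd] at h1
    rw [he] at h2
    change ((a : Mat n F) * (b : Mat n F)) 1 1 = 1
    rw [hd, he, diagonal_mul_diagonal]
    simp only [diagonal_apply_eq] at *
    rw [h1, h2, one_mul]
  inv_mem' := by
    rintro a ⟨ha, h1⟩
    have hi := inv_mem ha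
    refine ⟨hi, ?_⟩
    have h3 : (a : Mat n F) *
        ((a⁻¹ : SL n F) : Mat n F) = 1 := congrArg Subtype.val (mul_inv_cancel a)
    obtain ⟨_, d, _, hd⟩ := ha
    obtain ⟨_, e, _, he⟩ := hi
    simp only [rootβ] at *
    rw [hd] at h1
    rw [hd, he, diagonal_mul_diagonal] at h3
    have h4 := congrFun (congrFun h3 1) 1
    rw [he]
    simp only [diagonal_apply_eq, one_apply_eq] at *
    rwa [h1, one_mul] at h4

/-- The Lie algebra `𝔰𝔲(2,n;F) = {X ∈ 𝔰𝔩(n+2,F) | X J + J X† = 0}`, as a real vector space. -/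
def su (n : ℕ) (F : Type*) [RCLike F] :
    Submodule ℝ (Mat n F) where
  carrier := {X : Mat n F | X.trace = 0 ∧ X * formJ n F + formJ n F * Xᴴ = 0}
  zero_mem' := by simp
  add_mem' := by
    rintro X Y ⟨h1, h2⟩ ⟨h3, h4⟩
    refine ⟨by rw [trace_add, h1, h3, add_zero], ?_⟩
    rw [conjTranspose_add, Matrix.add_mul, Matrix.mul_add, add_add_add_comm, h2, h4, add_zero]
  smul_mem' := by
    rintro c X ⟨h1, h2⟩
    refine ⟨by rw [trace_smul, h1, smul_zero], ?_⟩
    rw [conjTranspose_smul, star_trivial, Matrix.smul_mul, Matrix.mul_smul, ← smul_add, h2,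
      smul_zero]

/-- The root space `𝔫_{pα + qβ}`: those `X ∈ 𝔰𝔲(2,n;F)` with `Ad(a) X = α(a)^p β(a)^q X` for
every `a ∈ A`. -/
def rootSpace (n : ℕ) (F : Type*) [RCLike F] (p q : ℕ) :
    Submodule ℝ (Mat n F) where
  carrier := {X : Mat n F | X ∈ su n F ∧ ∀ a ∈ A n F,
    (a : Mat n F) * X * ((a⁻¹ : SL n F) : Mat n F)
      = (rootα a ^ p * rootβ a ^ q) • X}
  zero_mem' := ⟨zero_mem _, by simp⟩
  add_mem' := by
    rintro X Y ⟨h1, h2⟩ ⟨h3, h4⟩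
    refine ⟨add_mem h1 h3, fun a ha => ?_⟩
    rw [Matrix.mul_add, Matrix.add_mul, h2 a ha, h4 a ha, smul_add]
  smul_mem' := by
    rintro c X ⟨h1, h2⟩
    refine ⟨Submodule.smul_mem _ _ h1, fun a ha => ?_⟩
    rw [Matrix.mul_smul, Matrix.smul_mul, h2 a ha, smul_comm]

/-- The Lie algebra of a closed subgroup `H` of `SL(n+2,F)`, as a set of matrices: all `X`
such that the one-parameter group `exp (tX)` lies in `H`. -/
def lieAlg (H : Subgroup (SL n F)) :
    Set (Mat n F) :=
  {X | ∀ t : ℝ, ∃ h ∈ H, (h : Mat n F) = NormedSpace.exp (t • X)}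

/-- The dimension of a closed subgroup `H`, i.e. the real dimension of its Lie algebra. (For
closed `H` the set `lieAlg H` is already a real subspace, so it equals its real span.) -/
noncomputable def dim (H : Subgroup (SL n F)) : ℕ :=
  Module.finrank ℝ (Submodule.span ℝ (lieAlg H))

/-- `T = A ∩ (HN)`. -/
def torusPart (H : Subgroup (SL n F)) :
    Set (SL n F) :=
  (A n F : Set _) ∩ ((H : Set _) * (N n F : Set _))

/-- `H` is compatible with `A`: `H ⊆ T U C_N(T)`, where `T = A ∩ (HN)`, `U = H ∩ N`, and
`C_N(T)` is the centralizer of `T` in `N`. -/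
def CompatibleWithA (H : Subgroup (SL n F)) : Prop :=
  (H : Set (SL n F)) ⊆
    torusPart H * ((H ⊓ N n F : Subgroup _) : Set _) *
      ((N n F ⊓ Subgroup.centralizer (torusPart H) : Subgroup _) : Set _)

/-- The maximum absolute value among the entries of a matrix. -/
noncomputable def maxNorm {ι : Type*} (M : Matrix ι ι F) : ℝ := ⨆ p : ι × ι, ‖M p.1 p.2‖

/-- `ρ(h) = h ∧ h`, given by the `2 × 2` minors of `h`: the entry in row `(j, m)` and column
`(k, l)` is the minor of `h` in the rows `j, m` and the columns `k, l`. -/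
def rho (h : SL n F) :
    Matrix (Fin (n + 2) × Fin (n + 2)) (Fin (n + 2) × Fin (n + 2)) F :=
  fun p q => det !![h.1 p.1 q.1, h.1 p.1 q.2; h.1 p.2 q.1, h.1 p.2 q.2]

/-- There is a continuous curve `h^t → ∞` in `H` with `ρ(h^t) ≍ ‖h^t‖²` as `t → ∞`. -/
def HasNearlyQuadraticCurve (H : Subgroup (SL n F)) : Prop :=
  ∃ h : ℝ → SL n F, Continuous h ∧ (∀ t, h t ∈ H) ∧
    Tendsto (fun t => maxNorm (h t).1) atTop atTop ∧
    (fun t => maxNorm (rho (h t))) =Θ[atTop] (fun t => maxNorm (h t).1 ^ 2)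

/-- `H = T ⋉ U`: `H` is the internal semidirect product of its subgroup `T` and its normal
subgroup `U`. -/
def IsSemidirect (H T U : Subgroup (SL n F)) : Prop :=
  T ≤ H ∧ U ≤ H ∧ (U.subgroupOf H).Normal ∧ T ⊓ U = ⊥ ∧ (H : Set (SL n F)) = (T : Set (SL n F)) * (U : Set (SL n F))

/-- The coordinate `φ_u`, the entry of `u` in row 1 and column 2. -/
def coordφ (u : Mat n F) : F := u 0 1

/-- The coordinate `η_u`, the entry of `u` in row 1 and column `n + 1`. -/
def coordη (u : Mat n F) : F := u 0 ⟨n, by omega⟩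

/-- `|x_u|²`, where `x_u ∈ F^(n-2)` consists of the entries of `u` in row 1 and columns
`3, …, n`. -/
noncomputable def normSqX (u : Mat n F) : ℝ :=
  ∑ j : Fin (n + 2) with 2 ≤ j.val ∧ j.val < n, ‖u 0 j‖ ^ 2

end SU2

/-! ### Closed multiplicative groups in a Banach algebra and their one-parameter subgroups. -/

section OneParameter

set_option linter.unusedSectionVars false

open NormedSpace Topology

variable {𝔸 : Type*} [NormedRing 𝔸] [NormedAlgebra ℝ 𝔸] [CompleteSpace 𝔸]

/-! The Lie algebra `L` of `H` consists of upper triangular matrices with real diagonal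
(`isBorel_of_mem_lieAlg`). The absence of a nearly quadratic curve enters twice.

Suppose `v ∈ L` lies in the ideal `𝔫_α + 𝔫_{α+β} + 𝔫_{α+2β} + 𝔫_{2α+2β}` and is isotropic for `|x|²
+ 2 Re(φ η̄)`. Then `v² = 0` and `exp(tv) = 1 + tv`. If `(φ, x, η) ≠ 0`, some 2 × 2 minor grows like
`t²`, which is forbidden (`hasNearlyQuadraticCurve_of_isHeis`). So the real space `W` of coordinates
`(φ, x, η)` of the ideal part of `L` is anisotropic. If `L` projected onto `𝔞`, compatibility would
put the wall `ker α` into `H`, again forbidden (`hasNearlyQuadraticCurve_of_diag_surjective`). So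
the projection to `𝔞` has dimension at most 1.

The rest is linear algebra. Up to a scalar and a sign, `ad X` acts on the coordinates through the
middle block of `X`, a skew map `c` with `c³ = t² c` that preserves `W`. Its eigenvectors for `±t ≠
0` are isotropic, and a nilpotent skew map vanishes on an anisotropic invariant space, so `c` kills
`W` (`act_eq_zero`).

Now count, with `d = dim F` and `n = m + 2`. If the nilpotent part of `L` lies in the ideal,
anisotropy makes `(x, η)` determine `φ`, and the corner entry is imaginary, giving at most `dm + d +
(d - 1) = dn - 1`. Otherwise a nilpotent `X` outside the ideal forces `φ = 0` on `W` and makes the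
possible `x` orthogonal to the middle entries of row 1, giving at most `dn - 2`
(`finrank_nilPart_add_two_le`). Adding 1 for `𝔞` gives the bound.

In case of equality every pair `(x, η)` occurs. The vector over `(0, 1)` has `φ ≠ 0`, and since it
is killed by every `c`, all middle blocks vanish (`structure_of_finrank_eq`). Hence elements of the
connected group `H` have identity middle block. The centralizing factor allowed by compatibility is
then trivial, so `ker β ⊆ H` (`kerβ_le`). -/

lemma exp_add_smul_real (X : 𝔸) (s t : ℝ) :
    exp ((s + t) • X) = exp (s • X) * exp (t • X) := by
  let _ : NormedAlgebra ℚ 𝔸 := NormedAlgebra.restrictScalars ℚ ℝ 𝔸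
  rw [add_smul]
  exact exp_add_of_commute ((Commute.refl X).smul_left s |>.smul_right t)

lemma exp_mul_exp_neg_real (X : 𝔸) : exp X * exp (-X) = 1 := by
  have h := exp_add_smul_real X 1 (-1)
  simpa using h.symm

lemma exp_neg_mul_exp_real (X : 𝔸) : exp (-X) * exp X = 1 := by
  simpa using exp_mul_exp_neg_real (-X)

/-- A closed subset of a Banach algebra that is a group under multiplication. -/
structure IsClosedMulGroup (S : Set 𝔸) : Prop where
  isClosed : IsClosed S
  one_mem : 1 ∈ S
  mul_mem : ∀ {a b}, a ∈ S → b ∈ S → a * b ∈ S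
  exists_inv : ∀ {a}, a ∈ S → ∃ b ∈ S, a * b = 1

/-- The generators of the one-parameter groups contained in `S`. -/
def oneParam (S : Set 𝔸) : Set 𝔸 := {X | ∀ t : ℝ, exp (t • X) ∈ S}

namespace IsClosedMulGroup

variable {S : Set 𝔸}

lemma pow_mem (hS : IsClosedMulGroup S) {a : 𝔸} (ha : a ∈ S) (k : ℕ) : a ^ k ∈ S := by
  induction k with
  | zero => simpa using hS.one_mem
  | succ k ih => rw [pow_succ]; exact hS.mul_mem ih ha

lemma exp_neg_mem (hS : IsClosedMulGroup S) {X : 𝔸} (h : exp X ∈ S) : exp (-X) ∈ S := by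
  obtain ⟨b, hb, hab⟩ := hS.exists_inv h
  have : exp (-X) = b := by
    calc exp (-X) = exp (-X) * (exp X * b) := by rw [hab, mul_one]
      _ = b := by rw [← mul_assoc, exp_neg_mul_exp_real, one_mul]
  rwa [this]

lemma exp_mem_of_oneParam {X : 𝔸} (h : X ∈ oneParam S) : exp X ∈ S := by
  simpa using h 1

/-- Limits of rescaled logarithms of elements of `S` generate one-parameter groups in `S`. -/
lemma mem_oneParam_of_tendsto (hS : IsClosedMulGroup S) {Z : ℕ → 𝔸} {c : ℕ → ℝ} {Y : 𝔸}
    (hZ : ∀ᶠ k in atTop, exp (Z k) ∈ S) (hc : Tendsto c atTop atTop)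
    (hY : Tendsto (fun k => c k • Z k) atTop (𝓝 Y)) : Y ∈ oneParam S := by
  let _ : NormedAlgebra ℚ 𝔸 := NormedAlgebra.restrictScalars ℚ ℝ 𝔸
  have key : ∀ t : ℝ, 0 ≤ t → exp (t • Y) ∈ S := by
    intro t ht
    -- Since `⌊t c_k⌋ / c_k → t`, the integer powers `exp(Z_k)^⌊t c_k⌋`, which lie in `S`, converge
    -- to `exp(tY)`.
    have h1 : Tendsto (fun k => ((⌊t * c k⌋₊ : ℝ) / c k) • (c k • Z k)) atTop (𝓝 (t • Y)) :=
      ((tendsto_nat_floor_mul_div_atTop ht).comp hc).smul hY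
    have h2 : Tendsto (fun k => exp (((⌊t * c k⌋₊ : ℝ) / c k) • (c k • Z k))) atTop
        (𝓝 (exp (t • Y))) := (exp_continuous.tendsto _).comp h1
    refine hS.isClosed.mem_of_tendsto h2 ?_
    filter_upwards [hZ, hc.eventually_gt_atTop 0] with k hk hck
    rw [smul_smul, div_mul_cancel₀ _ hck.ne', Nat.cast_smul_eq_nsmul, NormedSpace.exp_nsmul]
    exact hS.pow_mem hk _
  intro t
  rcases le_total 0 t with ht | ht
  · exact key t ht
  · have := hS.exp_neg_mem (key (-t) (by linarith))
    simpa using this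

lemma smul_mem_oneParam {X : 𝔸} (hX : X ∈ oneParam S) (c : ℝ) : c • X ∈ oneParam S := by
  intro t
  rw [smul_smul]
  exact hX _

lemma zero_mem_oneParam (hS : IsClosedMulGroup S) : (0 : 𝔸) ∈ oneParam S := by
  intro t
  simpa using hS.one_mem

/-- The curve `exp(sX) exp(sY)` lies in `S`, and its logarithm has derivative `X + Y` at 0, so
rescaled logarithms converge to `X + Y`. -/
lemma add_mem_oneParam (hS : IsClosedMulGroup S) {X Y : 𝔸} (hX : X ∈ oneParam S)
    (hY : Y ∈ oneParam S) : X + Y ∈ oneParam S := by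
  have hstr : HasStrictFDerivAt (exp : 𝔸 → 𝔸)
      ((ContinuousLinearEquiv.refl ℝ 𝔸 : 𝔸 ≃L[ℝ] 𝔸) : 𝔸 →L[ℝ] 𝔸) 0 := hasStrictFDerivAt_exp_zero
  -- `L` is a local logarithm near 1.
  let L := hstr.localInverse
  have hL : HasFDerivAt L (1 : 𝔸 →L[ℝ] 𝔸) 1 := by
    have := hstr.to_localInverse.hasFDerivAt
    rw [exp_zero] at this
    exact this
  have hL1 : L 1 = 0 := by
    have := hstr.localInverse_apply_image
    rwa [exp_zero] at this
  have hLr : ∀ᶠ y in 𝓝 (1 : 𝔸), exp (L y) = y := by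
    have := hstr.eventually_right_inverse
    rwa [exp_zero] at this
  have hγ : HasDerivAt (fun s : ℝ => exp (s • X) * exp (s • Y)) (X + Y) 0 := by
    have h1 := hasDerivAt_exp_smul_const (𝕂 := ℝ) X 0
    have h2 := hasDerivAt_exp_smul_const (𝕂 := ℝ) Y 0
    have h3 : HasDerivAt (fun s : ℝ => exp (s • X) * exp (s • Y)) _ 0 := h1.mul h2
    simpa [add_comm] using h3
  have hγ0 : exp ((0 : ℝ) • X) * exp ((0 : ℝ) • Y) = 1 := by simp
  have hcomp : HasDerivAt (fun s : ℝ => L (exp (s • X) * exp (s • Y))) (X + Y) 0 := by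
    have hL' : HasFDerivAt L (1 : 𝔸 →L[ℝ] 𝔸) (exp ((0 : ℝ) • X) * exp ((0 : ℝ) • Y)) := by
      rw [hγ0]; exact hL
    exact hL'.comp_hasDerivAt (0 : ℝ) hγ
  have hinv : Tendsto (fun k : ℕ => ((k : ℝ) + 1)⁻¹) atTop (𝓝[≠] 0) := by
    rw [tendsto_nhdsWithin_iff]
    refine ⟨?_, Eventually.of_forall fun k => ?_⟩
    · simpa using tendsto_one_div_add_atTop_nhds_zero_nat (𝕜 := ℝ)
    · have : (0 : ℝ) < (k : ℝ) + 1 := by positivity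
      exact inv_ne_zero this.ne'
  -- The logarithms at `s = 1/(k+1)`, rescaled by `k + 1`, are difference quotients at 0.
  refine hS.mem_oneParam_of_tendsto
    (Z := fun k : ℕ => L (exp ((((k : ℝ) + 1)⁻¹) • X) * exp ((((k : ℝ) + 1)⁻¹) • Y)))
    (c := fun k : ℕ => (k : ℝ) + 1) ?_ (tendsto_atTop_add_const_right _ _ tendsto_natCast_atTop_atTop) ?_
  · have h1 : Tendsto (fun k : ℕ => exp ((((k : ℝ) + 1)⁻¹) • X) * exp ((((k : ℝ) + 1)⁻¹) • Y))
        atTop (𝓝 1) := by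
      have := hγ.continuousAt.tendsto.comp (tendsto_nhdsWithin_iff.1 hinv).1
      rw [hγ0] at this
      exact this
    filter_upwards [h1.eventually hLr] with k hk
    rw [hk]
    exact hS.mul_mem (hX _) (hY _)
  · have h2 := (hasDerivAt_iff_tendsto_slope_zero.1 hcomp).comp hinv
    refine h2.congr fun k => ?_
    simp [hL1]

/-- The one-parameter generators of `S`, as a real subspace. -/
def lie (hS : IsClosedMulGroup S) : Submodule ℝ 𝔸 where
  carrier := oneParam S
  zero_mem' := hS.zero_mem_oneParam
  add_mem' := hS.add_mem_oneParam
  smul_mem' := fun c _ hX => smul_mem_oneParam hX c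

lemma conj_mem_lie (hS : IsClosedMulGroup S) {X Y : 𝔸} (hX : X ∈ hS.lie) (hY : Y ∈ hS.lie) :
    exp X * Y * exp (-X) ∈ hS.lie := by
  let _ : NormedAlgebra ℚ 𝔸 := NormedAlgebra.restrictScalars ℚ ℝ 𝔸
  intro t
  let U : 𝔸ˣ := ⟨exp X, exp (-X), exp_mul_exp_neg_real X, exp_neg_mul_exp_real X⟩
  have h : t • (exp X * Y * exp (-X)) = (U : 𝔸) * (t • Y) * (U⁻¹ : 𝔸ˣ) := by
    simp [U]
  rw [h, NormedSpace.exp_units_conj]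
  have hX' := exp_mem_of_oneParam hX
  exact hS.mul_mem (hS.mul_mem hX' (hY t)) (hS.exp_neg_mem hX')

/-- The bracket is the derivative at 0 of `exp(sX) Y exp(-sX)`, a curve in the Lie algebra, which is
closed because it has finite dimension. -/
lemma bracket_mem_lie [FiniteDimensional ℝ 𝔸] (hS : IsClosedMulGroup S) {X Y : 𝔸}
    (hX : X ∈ hS.lie) (hY : Y ∈ hS.lie) : X * Y - Y * X ∈ hS.lie := by
  have h1 := hasDerivAt_exp_smul_const (𝕂 := ℝ) X 0
  have h2 := hasDerivAt_exp_smul_const (𝕂 := ℝ) (-X) 0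
  have h3 : HasDerivAt (fun s : ℝ => exp (s • X) * Y * exp (s • (-X))) _ 0 :=
    (h1.mul_const Y).mul h2
  have h4 : HasDerivAt (fun s : ℝ => exp (s • X) * Y * exp (s • (-X))) (X * Y - Y * X) 0 := by
    have he : ∀ Z : 𝔸, exp ((0 : ℝ) • Z) = 1 := fun Z => by simp
    rw [he, he, one_mul, one_mul, mul_one, one_mul, mul_neg, ← sub_eq_add_neg] at h3
    exact h3
  have hcl : IsClosed (hS.lie : Set 𝔸) := Submodule.closed_of_finiteDimensional _
  have h5 := hasDerivAt_iff_tendsto_slope_zero.1 h4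
  refine hcl.mem_of_tendsto h5 (Eventually.of_forall fun s => ?_)
  refine hS.lie.smul_mem _ (hS.lie.sub_mem ?_ ?_)
  · have := hS.conj_mem_lie (hS.lie.smul_mem (0 + s) hX) hY
    simpa using this
  · simpa using hY

/-- Otherwise there are nonzero `Y_k → 0` in `C` with `exp Y_k ∈ S`. A limit `Z` of the unit vectors
`Y_k / ‖Y_k‖` lies in `C` and, by `mem_oneParam_of_tendsto`, in the Lie algebra, so disjointness
gives `Z = 0`, against `‖Z‖ = 1`. -/
lemma exists_ball_complement [FiniteDimensional ℝ 𝔸] (hS : IsClosedMulGroup S)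
    (C : Submodule ℝ 𝔸) (hC : Disjoint hS.lie C) :
    ∃ ε > 0, ∀ Y ∈ C, ‖Y‖ < ε → exp Y ∈ S → Y = 0 := by
  by_contra! hcon
  have hpos : ∀ k : ℕ, (0 : ℝ) < ((k : ℝ) + 1)⁻¹ := fun k => by positivity
  choose Y hYC hYn hYS hY0 using fun k : ℕ => hcon _ (hpos k)
  have hcomp : IsCompact (Metric.sphere (0 : 𝔸) 1 ∩ (C : Set 𝔸)) := by
    have : ProperSpace 𝔸 := FiniteDimensional.proper ℝ 𝔸
    exact (isCompact_sphere 0 1).inter_right (Submodule.closed_of_finiteDimensional C)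
  have hmem : ∀ k, ‖Y k‖⁻¹ • Y k ∈ Metric.sphere (0 : 𝔸) 1 ∩ (C : Set 𝔸) := fun k => by
    refine ⟨?_, C.smul_mem _ (hYC k)⟩
    simp [norm_smul, hY0 k]
  obtain ⟨Z, ⟨hZ1, hZC⟩, φ, hφ, hlim⟩ := hcomp.tendsto_subseq hmem
  have hYlim : Tendsto (fun k => ‖Y k‖) atTop (𝓝[>] 0) := by
    rw [tendsto_nhdsWithin_iff]
    refine ⟨?_, Eventually.of_forall fun k => norm_pos_iff.2 (hY0 k)⟩
    refine squeeze_zero (fun k => norm_nonneg _) (fun k => (hYn k).le) ?_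
    simpa using tendsto_one_div_add_atTop_nhds_zero_nat (𝕜 := ℝ)
  have hZL : Z ∈ hS.lie := hS.mem_oneParam_of_tendsto (Z := fun k => Y (φ k))
    (c := fun k => ‖Y (φ k)‖⁻¹) (Eventually.of_forall fun k => hYS _)
    ((tendsto_inv_nhdsGT_zero.comp hYlim).comp hφ.tendsto_atTop) hlim
  have : Z = 0 := Submodule.disjoint_def.1 hC Z hZL hZC
  rw [this] at hZ1
  simp at hZ1

/-- Elements of `S` near the identity are exponentials of elements of its Lie algebra. -/
lemma eventually_mem_exp_image [FiniteDimensional ℝ 𝔸] (hS : IsClosedMulGroup S) :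
    ∀ᶠ g in 𝓝 (1 : 𝔸), g ∈ S → ∃ X ∈ hS.lie, g = exp X := by
  obtain ⟨C, hC⟩ := hS.lie.exists_isCompl
  obtain ⟨ε, hε, hεC⟩ := hS.exists_ball_complement C hC.disjoint
  let Φ : hS.lie × C → 𝔸 := fun p => exp (p.1 : 𝔸) * exp (p.2 : 𝔸)
  let f1 : hS.lie × C →L[ℝ] 𝔸 := hS.lie.subtypeL.comp (ContinuousLinearMap.fst ℝ _ _)
  let f2 : hS.lie × C →L[ℝ] 𝔸 := C.subtypeL.comp (ContinuousLinearMap.snd ℝ _ _)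
  have he : ∀ f : hS.lie × C →L[ℝ] 𝔸, HasStrictFDerivAt (fun p => exp (f p)) f 0 := by
    intro f
    have h1 : HasStrictFDerivAt (exp : 𝔸 → 𝔸) (1 : 𝔸 →L[ℝ] 𝔸) (f 0) := by
      rw [map_zero]; exact hasStrictFDerivAt_exp_zero
    exact h1.comp 0 f.hasStrictFDerivAt
  have hΦ : HasStrictFDerivAt Φ (f1 + f2) 0 := by
    have h : HasStrictFDerivAt Φ _ 0 := (he f1).mul' (he f2)
    have h' : exp (f1 0) • f2 + MulOpposite.op (exp (f2 0)) • f1 = f1 + f2 := by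
      rw [map_zero, map_zero, exp_zero, one_smul, MulOpposite.op_one, one_smul, add_comm]
    rw [← h']
    exact h
  -- The derivative of `(X, Y) ↦ exp X exp Y` at 0 is the sum map from `lie × C`, which is onto.
  -- Hence products with `Y` small fill a neighbourhood of 1.
  have hsurj : (f1 + f2).range = ⊤ := by
    rw [eq_top_iff]
    intro x _
    have hx : x ∈ hS.lie ⊔ C := by rw [hC.sup_eq_top]; trivial
    obtain ⟨a, ha, b, hb, rfl⟩ := Submodule.mem_sup.1 hx
    exact ⟨(⟨a, ha⟩, ⟨b, hb⟩), by simp [f1, f2]⟩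
  have hmap := hΦ.map_nhds_eq_of_surj hsurj
  have hΦ0 : Φ 0 = 1 := by simp [Φ]
  rw [hΦ0] at hmap
  have hV : ∀ᶠ p : hS.lie × C in 𝓝 0, ‖p.2‖ < ε := by
    have : Tendsto (fun p : hS.lie × C => ‖p.2‖) (𝓝 0) (𝓝 0) := by
      have h := (continuous_snd.norm : Continuous fun p : hS.lie × C => ‖p.2‖).tendsto 0
      simpa using h
    exact this.eventually (gt_mem_nhds hε)
  have himg : Φ '' {p | ‖p.2‖ < ε} ∈ 𝓝 (1 : 𝔸) := by
    rw [← hmap]; exact image_mem_map hV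
  filter_upwards [himg]
  rintro g ⟨⟨X, Y⟩, hY, rfl⟩ hg
  refine ⟨X, X.2, ?_⟩
  -- Cancelling `exp X` leaves `exp Y ∈ S` with `Y` small in the complement, so `Y = 0`.
  have h1 : exp (Y : 𝔸) ∈ S := by
    have h2 := hS.mul_mem (hS.exp_neg_mem (exp_mem_of_oneParam X.2)) hg
    rwa [← mul_assoc, exp_neg_mul_exp_real, one_mul] at h2
  have h3 := hεC Y Y.2 hY h1
  simp [Φ, h3]

end IsClosedMulGroup

end OneParameter

namespace SU2

/-! ### Lie algebras of closed matrix groups. -/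

section ClosedSubgroups

open Topology

attribute [local instance] Matrix.linftyOpNormedRing Matrix.linftyOpNormedAlgebra

variable {n : ℕ} {F : Type*} [RCLike F]

lemma isClosedMulGroup_image {H : Subgroup (SL n F)} (hcl : IsClosed (H : Set (SL n F))) :
    IsClosedMulGroup ((fun g : SL n F => (g : Mat n F)) '' H) where
  isClosed := SpecialLinearGroup.isClosedEmbedding_val.isClosedMap _ hcl
  one_mem := ⟨1, one_mem H, rfl⟩
  mul_mem := by
    rintro _ _ ⟨a, ha, rfl⟩ ⟨b, hb, rfl⟩
    exact ⟨a * b, mul_mem ha hb, rfl⟩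
  exists_inv := by
    rintro _ ⟨a, ha, rfl⟩
    exact ⟨_, ⟨a⁻¹, inv_mem ha, rfl⟩, congrArg Subtype.val (mul_inv_cancel a)⟩

/-- The Lie algebra of a closed subgroup, as a real subspace. -/
noncomputable def lieSub (H : Subgroup (SL n F)) (hcl : IsClosed (H : Set (SL n F))) :
    Submodule ℝ (Mat n F) where
  carrier := lieAlg H
  zero_mem' := (isClosedMulGroup_image hcl).zero_mem_oneParam
  add_mem' := (isClosedMulGroup_image hcl).add_mem_oneParam
  smul_mem' := fun c _ hX => IsClosedMulGroup.smul_mem_oneParam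
    (S := (fun g : SL n F => (g : Mat n F)) '' H) hX c

lemma dim_eq_finrank_lieSub (H : Subgroup (SL n F)) (hcl : IsClosed (H : Set (SL n F))) :
    dim H = Module.finrank ℝ (lieSub H hcl) := by
  have h : Submodule.span ℝ (lieAlg H) = lieSub H hcl := Submodule.span_eq (lieSub H hcl)
  rw [dim, h]

lemma bracket_mem_lieSub {H : Subgroup (SL n F)} {hcl : IsClosed (H : Set (SL n F))}
    {X Y : Mat n F} (hX : X ∈ lieSub H hcl) (hY : Y ∈ lieSub H hcl) :
    X * Y - Y * X ∈ lieSub H hcl := by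
  have : FiniteDimensional ℝ (Mat n F) := Module.Finite.trans F _
  exact (isClosedMulGroup_image hcl).bracket_mem_lie (X := X) (Y := Y) hX hY

/-- A connected closed subgroup is generated by the exponentials of its Lie algebra. -/
lemma le_of_exp_mem {H K : Subgroup (SL n F)} (hcl : IsClosed (H : Set (SL n F)))
    (hconn : IsConnected (H : Set (SL n F)))
    (hK : ∀ X ∈ lieAlg H, ∀ h ∈ H, (h : Mat n F) = NormedSpace.exp X → h ∈ K) : H ≤ K := by
  have : FiniteDimensional ℝ (Mat n F) := Module.Finite.trans F _
  have hev := (isClosedMulGroup_image hcl).eventually_mem_exp_image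
  have hcont : Continuous (fun g : H => ((g : SL n F) : Mat n F)) :=
    SpecialLinearGroup.isClosedEmbedding_val.continuous.comp continuous_subtype_val
  -- `K` contains a neighbourhood of 1 in `H`, so `K ∩ H` is open and closed in the connected group
  -- `H`.
  have hnear : ∀ᶠ g : H in 𝓝 1, g ∈ K.subgroupOf H := by
    have h1 := (hcont.tendsto 1).eventually hev
    filter_upwards [h1] with g hg
    obtain ⟨X, hX, hgX⟩ := hg ⟨g, g.2, rfl⟩
    exact hK X hX g g.2 hgX
  have hopen : IsOpen ((K.subgroupOf H : Subgroup H) : Set H) :=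
    Subgroup.isOpen_of_mem_nhds _ hnear
  have hclosed := Subgroup.isClosed_of_isOpen _ hopen
  have : ConnectedSpace H := isConnected_iff_connectedSpace.1 hconn
  have huniv := IsClopen.eq_univ ⟨hclosed, hopen⟩ ⟨1, one_mem _⟩
  intro g hg
  have : (⟨g, hg⟩ : H) ∈ ((K.subgroupOf H : Subgroup H) : Set H) := by rw [huniv]; trivial
  exact this

lemma hasDerivAt_exp_entry (X : Mat n F) (i j : Fin (n + 2)) :
    HasDerivAt (fun t : ℝ => NormedSpace.exp (t • X) i j) (X i j) 0 := by
  have h := hasDerivAt_exp_smul_const (𝕂 := ℝ) X 0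
  rw [zero_smul, NormedSpace.exp_zero, one_mul] at h
  exact hasDerivAt_pi.1 (hasDerivAt_pi.1 h i) j

lemma continuous_exp_smul (X : Mat n F) : Continuous (fun t : ℝ => NormedSpace.exp (t • X)) := by
  let _ : NormedAlgebra ℚ (Mat n F) := NormedAlgebra.restrictScalars ℚ ℝ (Mat n F)
  exact NormedSpace.exp_continuous.comp (continuous_id.smul continuous_const)

lemma hasSum_exp_entry (X : Mat n F) (i j : Fin (n + 2)) :
    HasSum (fun k : ℕ => ((k.factorial : ℝ)⁻¹) • (X ^ k) i j) (NormedSpace.exp X i j) := by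
  have h := NormedSpace.exp_series_hasSum_exp' (𝕂 := ℝ) X
  exact (Pi.hasSum.1 (Pi.hasSum.1 h i)) j

lemma exp_neg_mul_exp (X : Mat n F) : NormedSpace.exp (-X) * NormedSpace.exp X = 1 :=
  exp_neg_mul_exp_real X

lemma exp_of_sq_zero {X : Mat n F} (hX : X * X = 0) : NormedSpace.exp X = 1 + X := by
  ext i j
  have h := hasSum_exp_entry X i j
  have h2 := hasSum_sum_of_ne_finset_zero (L := SummationFilter.unconditional ℕ) (f := fun k : ℕ => ((k.factorial : ℝ)⁻¹) • (X ^ k) i j)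
    (s := Finset.range 2) (by
      intro k hk
      obtain ⟨l, rfl⟩ : ∃ l, k = 2 + l := ⟨k - 2, by simp at hk; omega⟩
      simp [pow_add, pow_two, hX])
  rw [h.unique h2]
  simp [Finset.sum_range_succ]

lemma exp_diag_of_blockTriangular {X : Mat n F} (hX : X.BlockTriangular id) (i : Fin (n + 2)) :
    NormedSpace.exp X i i = NormedSpace.exp (X i i) := by
  have hpow : ∀ k : ℕ, (X ^ k).BlockTriangular id ∧ (X ^ k) i i = (X i i) ^ k := by
    intro k
    induction k with
    | zero => exact ⟨by simpa using blockTriangular_one, by simp⟩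
    | succ k ih =>
      refine ⟨by rw [pow_succ]; exact ih.1.mul hX, ?_⟩
      rw [pow_succ, Matrix.mul_apply, Finset.sum_eq_single i, ih.2, pow_succ]
      · intro j _ hj
        rcases lt_or_gt_of_ne hj with h | h
        · rw [ih.1 h, zero_mul]
        · rw [hX h, mul_zero]
      · simp
  have h := hasSum_exp_entry X i i
  simp only [(hpow _).2] at h
  exact h.unique (NormedSpace.exp_series_hasSum_exp' (𝕂 := ℝ) (X i i))

end ClosedSubgroups

/-! ### Matrix coordinates, the quadratic form, and the action of the middle block. -/

section Coordinates

variable {m : ℕ}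

/-- The indices of the middle block. -/
def md (j : Fin m) : Fin (m + 2 + 2) := ⟨j.val + 2, by omega⟩

/-- The second to last index. -/
def pn : Fin (m + 2 + 2) := ⟨m + 2, by omega⟩

/-- The last index. -/
def pl : Fin (m + 2 + 2) := ⟨m + 3, by omega⟩

/-- The involution of the index set that defines the permutation matrix `formJ`. -/
def flip (i : Fin (m + 2 + 2)) : Fin (m + 2 + 2) :=
  if i.val < 2 ∨ m + 2 ≤ i.val then ⟨m + 3 - i.val, by omega⟩ else i

lemma index_cases {P : Fin (m + 2 + 2) → Prop} (h0 : P 0) (h1 : P 1) (hm : ∀ j, P (md j))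
    (hn : P pn) (hl : P pl) (i : Fin (m + 2 + 2)) : P i := by
  rcases i with ⟨i, hi⟩
  by_cases h : i = 0
  · subst h; exact h0
  by_cases h : i = 1
  · subst h; exact h1
  by_cases h : i = m + 2
  · subst h; exact hn
  by_cases h : i = m + 3
  · subst h; exact hl
  have := hm ⟨i - 2, by omega⟩
  simp only [md] at this
  convert this
  omega

lemma sum_index {M : Type*} [AddCommMonoid M] (f : Fin (m + 2 + 2) → M) :
    ∑ i, f i = f 0 + (f 1 + (∑ j : Fin m, f (md j) + f pn + f pl)) := by
  rw [Fin.sum_univ_succ, Fin.sum_univ_succ, Fin.sum_univ_castSucc, Fin.sum_univ_castSucc]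
  rfl

@[simp] lemma flip_zero : flip (0 : Fin (m + 2 + 2)) = pl := by simp [flip, pl]
@[simp] lemma flip_one : flip (1 : Fin (m + 2 + 2)) = pn := by simp [flip, pn]
@[simp] lemma flip_md (j : Fin m) : flip (md j) = md j := by
  have := j.2
  rw [flip, if_neg (by simp only [md]; omega)]
@[simp] lemma flip_pn : flip (pn : Fin (m + 2 + 2)) = 1 := by
  simp [flip, pn]
@[simp] lemma flip_pl : flip (pl : Fin (m + 2 + 2)) = 0 := by
  simp [flip, pl]
@[simp] lemma flip_flip (i : Fin (m + 2 + 2)) : flip (flip i) = i := by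
  induction i using index_cases <;> simp

@[simp] lemma zero_lt_md (j : Fin m) : (0 : Fin (m + 2 + 2)) < md j := by
  simp [Fin.lt_def, md]
@[simp] lemma one_lt_md (j : Fin m) : (1 : Fin (m + 2 + 2)) < md j := by
  simp [Fin.lt_def, md]
@[simp] lemma md_lt_pn (j : Fin m) : md j < pn := by simp [Fin.lt_def, md, pn]
@[simp] lemma md_lt_pl (j : Fin m) : md j < pl := by simp [Fin.lt_def, md, pl]
@[simp] lemma zero_lt_pn : (0 : Fin (m + 2 + 2)) < pn := by simp [Fin.lt_def, pn]
@[simp] lemma zero_lt_pl : (0 : Fin (m + 2 + 2)) < pl := by simp [Fin.lt_def, pl]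
@[simp] lemma one_lt_pn : (1 : Fin (m + 2 + 2)) < pn := by simp [Fin.lt_def, pn]
@[simp] lemma one_lt_pl : (1 : Fin (m + 2 + 2)) < pl := by simp [Fin.lt_def, pl]
@[simp] lemma pn_lt_pl : (pn : Fin (m + 2 + 2)) < pl := by simp [Fin.lt_def, pn, pl]
@[simp] lemma md_lt_md {a b : Fin m} : md a < md b ↔ a < b := by
  simp only [Fin.lt_def, md]; omega
lemma md_injective : Function.Injective (md : Fin m → Fin (m + 2 + 2)) := fun a b h => by
  simpa [md, Fin.ext_iff] using h
@[simp] lemma zero_lt_one_index : (0 : Fin (m + 2 + 2)) < 1 := by simp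

variable {F : Type*} [RCLike F]

lemma formJ_apply (i j : Fin (m + 2 + 2)) :
    formJ (m + 2) F i j = if j = flip i then 1 else 0 := by
  have hi := i.2
  have hj := j.2
  simp only [formJ, flip, Fin.ext_iff]
  by_cases h : i.val < 2 ∨ m + 2 ≤ i.val
  · simp only [if_pos h]
    congr 1
    simp only [eq_iff_iff]
    omega
  · simp only [if_neg h]
    congr 1
    simp only [eq_iff_iff]
    omega

lemma mul_formJ_apply (M : Mat (m + 2) F) (i j : Fin (m + 2 + 2)) :
    (M * formJ (m + 2) F) i j = M i (flip j) := by
  rw [Matrix.mul_apply, Finset.sum_eq_single (flip j)]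
  · simp [formJ_apply]
  · intro k _ hk
    rw [formJ_apply, if_neg, mul_zero]
    rintro rfl
    simp at hk
  · simp

lemma formJ_mul_apply (M : Mat (m + 2) F) (i j : Fin (m + 2 + 2)) :
    (formJ (m + 2) F * M) i j = M (flip i) j := by
  rw [Matrix.mul_apply, Finset.sum_eq_single (flip i)]
  · simp [formJ_apply]
  · intro k _ hk
    rw [formJ_apply, if_neg hk, zero_mul]
  · simp

lemma mul_formJ_add_iff {X : Mat (m + 2) F} :
    X * formJ (m + 2) F + formJ (m + 2) F * Xᴴ = 0 ↔
      ∀ i j, X i j = -star (X (flip j) (flip i)) := by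
  constructor
  · intro h i j
    have := congrFun (congrFun h i) (flip j)
    rw [Matrix.add_apply, mul_formJ_apply, formJ_mul_apply, flip_flip, conjTranspose_apply] at this
    exact eq_neg_of_add_eq_zero_left this
  · intro h
    ext i j
    rw [Matrix.add_apply, mul_formJ_apply, formJ_mul_apply, conjTranspose_apply, h i (flip j)]
    simp

/-- The upper triangular elements of the Lie algebra with real diagonal entries. -/
structure IsBorel (X : Mat (m + 2) F) : Prop where
  upper : X.BlockTriangular id
  real : ∀ i, star (X i i) = X i i
  skew : ∀ i j, X i j = -star (X (flip j) (flip i))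

namespace IsBorel

variable {X : Mat (m + 2) F}

lemma eq_zero_of_lt (h : IsBorel X) {i j : Fin (m + 2 + 2)} (hij : j < i) : X i j = 0 :=
  h.upper hij

/-- Skewness exchanges the two triangles of the middle block, one of which is zero. On its diagonal,
entries are both real and purely imaginary. -/
lemma md_md (h : IsBorel X) (a b : Fin m) : X (md a) (md b) = 0 := by
  rcases lt_trichotomy a b with hab | rfl | hab
  · rw [h.skew, flip_md, flip_md, h.eq_zero_of_lt (by simpa using hab)]; simp
  · have h1 := h.skew (md a) (md a)
    rw [flip_md, h.real] at h1
    exact self_eq_neg.1 h1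
  · exact h.eq_zero_of_lt (by simpa using hab)

lemma pl_pl (h : IsBorel X) : X pl pl = -X 0 0 := by rw [h.skew, flip_pl, h.real]
lemma pn_pn (h : IsBorel X) : X pn pn = -X 1 1 := by rw [h.skew, flip_pn, h.real]
lemma md_pn (h : IsBorel X) (j : Fin m) : X (md j) pn = -star (X 1 (md j)) := by
  rw [h.skew, flip_pn, flip_md]
lemma md_pl (h : IsBorel X) (j : Fin m) : X (md j) pl = -star (X 0 (md j)) := by
  rw [h.skew, flip_pl, flip_md]
lemma pn_pl (h : IsBorel X) : X pn pl = -star (X 0 1) := by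
  rw [h.skew, flip_pl, flip_pn]
lemma one_pl (h : IsBorel X) : X 1 pl = -star (X 0 pn) := by
  rw [h.skew, flip_pl, flip_one]
lemma star_zero_pl (h : IsBorel X) : star (X 0 pl) = -X 0 pl := by
  have := h.skew 0 pl
  rw [flip_pl, flip_zero] at this
  rw [eq_neg_iff_add_eq_zero, add_comm, ← eq_neg_iff_add_eq_zero, ← this]
lemma star_one_pn (h : IsBorel X) : star (X 1 pn) = -X 1 pn := by
  have := h.skew 1 pn
  rw [flip_pn, flip_one] at this
  rw [eq_neg_iff_add_eq_zero, add_comm, ← eq_neg_iff_add_eq_zero, ← this]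
lemma coe_re (h : IsBorel X) (i : Fin (m + 2 + 2)) : ((RCLike.re (X i i) : ℝ) : F) = X i i :=
  RCLike.conj_eq_iff_re.1 (h.real i)

lemma one_zero (h : IsBorel X) : X 1 0 = 0 := h.eq_zero_of_lt (by simp)
lemma md_zero (h : IsBorel X) (j : Fin m) : X (md j) 0 = 0 := h.eq_zero_of_lt (by simp)
lemma md_one (h : IsBorel X) (j : Fin m) : X (md j) 1 = 0 := h.eq_zero_of_lt (by simp)
lemma pn_zero (h : IsBorel X) : X pn 0 = 0 := h.eq_zero_of_lt (by simp)
lemma pn_one (h : IsBorel X) : X pn 1 = 0 := h.eq_zero_of_lt (by simp)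
lemma pn_md (h : IsBorel X) (j : Fin m) : X pn (md j) = 0 := h.eq_zero_of_lt (by simp)
lemma pl_zero (h : IsBorel X) : X pl 0 = 0 := h.eq_zero_of_lt (by simp)
lemma pl_one (h : IsBorel X) : X pl 1 = 0 := h.eq_zero_of_lt (by simp)
lemma pl_md (h : IsBorel X) (j : Fin m) : X pl (md j) = 0 := h.eq_zero_of_lt (by simp)
lemma pl_pn (h : IsBorel X) : X pl pn = 0 := h.eq_zero_of_lt (by simp)

end IsBorel

/-- The elements of the ideal `𝔫_α + 𝔫_{α+β} + 𝔫_{α+2β} + 𝔫_{2α+2β}`. -/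
structure IsHeis (v : Mat (m + 2) F) : Prop extends IsBorel v where
  zero_zero : v 0 0 = 0
  one_one : v 1 1 = 0
  one_md : ∀ j, v 1 (md j) = 0
  one_pn : v 1 pn = 0

namespace IsHeis

variable {v : Mat (m + 2) F}

/-- All entries outside the first row and the last column vanish. -/
lemma eq_zero (h : IsHeis v) {i j : Fin (m + 2 + 2)} (hi : i ≠ 0) (hj : j ≠ pl) : v i j = 0 := by
  induction i using index_cases with
  | h0 => exact absurd rfl hi
  | h1 => induction j using index_cases with
    | h0 => exact h.one_zero
    | h1 => exact h.one_one
    | hm j => exact h.one_md j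
    | hn => exact h.one_pn
    | hl => exact absurd rfl hj
  | hm i => induction j using index_cases with
    | h0 => exact h.md_zero i
    | h1 => exact h.md_one i
    | hm j => exact h.md_md i j
    | hn => rw [h.md_pn, h.one_md]; simp
    | hl => exact absurd rfl hj
  | hn => induction j using index_cases with
    | h0 => exact h.pn_zero
    | h1 => exact h.pn_one
    | hm j => exact h.pn_md j
    | hn => rw [h.pn_pn, h.one_one]; simp
    | hl => exact absurd rfl hj
  | hl => induction j using index_cases with
    | h0 => exact h.pl_zero
    | h1 => exact h.pl_one
    | hm j => exact h.pl_md j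
    | hn => exact h.pl_pn
    | hl => exact absurd rfl hj

lemma pl_pl' (h : IsHeis v) : v pl pl = 0 := by rw [h.pl_pl, h.zero_zero]; simp

end IsHeis

/-- The real vector space `F × F^(n-2) × F` of the coordinates `(φ, x, η)`. -/
abbrev Coord (m : ℕ) (F : Type*) := F × (Fin m → F) × F

/-- The coordinates `(φ, x, η)` of a matrix. -/
def coord : Mat (m + 2) F →ₗ[ℝ] Coord m F where
  toFun X := (X 0 1, fun j => X 0 (md j), X 0 pn)
  map_add' _ _ := rfl
  map_smul' _ _ := rfl

lemma coord_apply (X : Mat (m + 2) F) : coord X = (X 0 1, fun j => X 0 (md j), X 0 pn) := rfl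

/-- The bilinear form whose quadratic form is `|x|² + 2 Re (φ η̄)`. -/
noncomputable def form (p q : Coord m F) : ℝ :=
  RCLike.re (∑ j, p.2.1 j * star (q.2.1 j) + p.1 * star q.2.2 + p.2.2 * star q.1)

lemma form_comm (p q : Coord m F) : form p q = form q p := by
  have h : star (∑ j, p.2.1 j * star (q.2.1 j) + p.1 * star q.2.2 + p.2.2 * star q.1)
      = ∑ j, q.2.1 j * star (p.2.1 j) + q.1 * star p.2.2 + q.2.2 * star p.1 := by
    simp only [star_add, star_sum, star_mul', star_star]
    rw [Finset.sum_congr rfl fun j _ => mul_comm _ _]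
    ring
  rw [form, form, ← h]
  exact (RCLike.conj_re _).symm

lemma form_smul_right (p q : Coord m F) (t : ℝ) : form p (t • q) = t * form p q := by
  have : ∑ j, p.2.1 j * star ((t • q).2.1 j) + p.1 * star (t • q).2.2 + p.2.2 * star (t • q).1
      = t • (∑ j, p.2.1 j * star (q.2.1 j) + p.1 * star q.2.2 + p.2.2 * star q.1) := by
    simp only [Prod.smul_snd, Prod.smul_fst, Pi.smul_apply, star_smul, star_trivial,
      mul_smul_comm, smul_add, Finset.smul_sum]
  rw [form, this, RCLike.smul_re, form]

/-- The action of the middle block of `X` on row vectors. -/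
noncomputable def act (X : Mat (m + 2) F) : Coord m F →ₗ[ℝ] Coord m F where
  toFun p := (p.1 * X 1 1, fun j => p.1 * X 1 (md j),
    p.1 * X 1 pn - ∑ j, p.2.1 j * star (X 1 (md j)) - p.2.2 * X 1 1)
  map_add' p q := by
    refine Prod.ext (add_mul _ _ _) (Prod.ext (funext fun j => add_mul _ _ _) ?_)
    simp only [Prod.snd_add, Prod.fst_add, Pi.add_apply, add_mul, Finset.sum_add_distrib]
    ring
  map_smul' c p := by
    refine Prod.ext (smul_mul_assoc _ _ _) (Prod.ext (funext fun j => smul_mul_assoc _ _ _) ?_)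
    simp only [Prod.smul_snd, Prod.smul_fst, Pi.smul_apply, smul_mul_assoc, ← Finset.smul_sum,
      smul_sub, RingHom.id_apply]

lemma act_apply (X : Mat (m + 2) F) (p : Coord m F) :
    act X p = (p.1 * X 1 1, fun j => p.1 * X 1 (md j),
      p.1 * X 1 pn - ∑ j, p.2.1 j * star (X 1 (md j)) - p.2.2 * X 1 1) := rfl

/-- The middle block of `X` lies in the Lie algebra of the isometry group of the form: `X 1 1` is
real and `X 1 pn` is imaginary. -/
lemma form_act {X : Mat (m + 2) F} (hX : IsBorel X) (p q : Coord m F) :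
    form (act X p) q = -form p (act X q) := by
  rw [form, form, ← map_neg]
  congr 1
  simp only [act, LinearMap.coe_mk, AddHom.coe_mk, star_sub, star_mul', star_sum, star_star,
    hX.real, hX.star_one_pn, sub_mul, mul_sub, Finset.sum_mul, Finset.mul_sum]
  have e1 : ∑ j, p.1 * X 1 (md j) * star (q.2.1 j) = ∑ j, p.1 * (star (q.2.1 j) * X 1 (md j)) :=
    Finset.sum_congr rfl fun j _ => by ring
  have e2 : ∑ j, p.2.1 j * (star q.1 * star (X 1 (md j)))
      = ∑ j, p.2.1 j * star (X 1 (md j)) * star q.1 :=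
    Finset.sum_congr rfl fun j _ => by ring
  rw [e1, e2]
  ring

/-- The action is block triangular with eigenvalues `t, 0, -t`, where `t = X 1 1`: `c - t` maps
everything into `φ = 0`, `c` maps that into `φ = 0, x = 0`, and `c + t` kills the latter. -/
lemma act_cube {X : Mat (m + 2) F} (hX : IsBorel X) (p : Coord m F) :
    act X (act X (act X p)) = (RCLike.re (X 1 1) ^ 2) • act X p := by
  have hs : ∀ z : F, (RCLike.re (X 1 1) ^ 2) • z = X 1 1 ^ 2 * z := fun z => by
    rw [RCLike.real_smul_eq_coe_mul, RCLike.ofReal_pow, hX.coe_re]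
  refine Prod.ext ?_ (Prod.ext (funext fun j => ?_) ?_)
  · simp only [act, LinearMap.coe_mk, AddHom.coe_mk, Prod.smul_fst, hs]; ring
  · simp only [act, LinearMap.coe_mk, AddHom.coe_mk, Prod.smul_fst, Prod.smul_snd, Pi.smul_apply,
      hs]; ring
  · simp only [act, LinearMap.coe_mk, AddHom.coe_mk, Prod.smul_snd, hs]
    have e : ∑ j, p.1 * X 1 1 * X 1 (md j) * star (X 1 (md j))
        = X 1 1 * ∑ j, p.1 * X 1 (md j) * star (X 1 (md j)) := by
      rw [Finset.mul_sum]
      exact Finset.sum_congr rfl fun j _ => by ring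
    rw [e]; ring

/-- A skew map `c` with `c³ = t² c` kills the invariant anisotropic subspaces. -/
lemma act_eq_zero {X : Mat (m + 2) F} (hX : IsBorel X) (W : Submodule ℝ (Coord m F))
    (hW : ∀ p ∈ W, act X p ∈ W) (han : ∀ p ∈ W, form p p = 0 → p = 0) {p : Coord m F}
    (hp : p ∈ W) : act X p = 0 := by
  set c := act X with hc
  set t : ℝ := RCLike.re (X 1 1) with ht
  have hskew : ∀ q, form q (c q) = 0 := fun q => by
    have h1 := form_act hX q q
    rw [form_comm] at h1
    linarith [h1]
  have h3 := act_cube hX p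
  rw [← hc, ← ht] at h3
  have hc1 := hW p hp
  have hc2 := hW _ hc1
  -- If `t = 0`, then `c³ p = 0`. Skewness gives `form (c²p) (c²p) = -form (cp) (c³p) = 0`, so `c²p
  -- = 0`; the same argument then gives `cp = 0`.
  by_cases h0 : t = 0
  · rw [h0] at h3
    have h3 : c (c (c p)) = 0 := by simpa using h3
    have z : ∀ q : Coord m F, form q 0 = 0 := fun q => by simp [form]
    have h4 : c (c p) = 0 := by
      refine han _ hc2 ?_
      rw [hc, form_act hX, ← hc, h3, z, neg_zero]
    refine han _ hc1 ?_
    rw [hc, form_act hX, ← hc, h4, z, neg_zero]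
  -- For `s = ±t` the vector `q = c²p + s cp` satisfies `cq = sq`. Since `form q (cq) = 0`, it is
  -- isotropic, hence zero. Subtracting the two relations isolates `cp`.
  · have key : ∀ s : ℝ, s ^ 2 = t ^ 2 → c (c p) + s • c p = 0 := by
      intro s hs
      have hs0 : s ≠ 0 := by
        rintro rfl
        exact h0 (by simpa using hs.symm)
      have he : c (c (c p) + s • c p) = s • (c (c p) + s • c p) := by
        rw [map_add, map_smul, h3, ← hs]
        module
      refine han _ (W.add_mem hc2 (W.smul_mem _ hc1)) ?_
      have h5 := hskew (c (c p) + s • c p)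
      rw [he, form_smul_right] at h5
      exact (mul_eq_zero.1 h5).resolve_left hs0
    have h6 := key t rfl
    have h7 := key (-t) (by ring)
    have h8 : (2 * t) • c p = 0 := by
      have : (2 * t) • c p = (c (c p) + t • c p) - (c (c p) + (-t) • c p) := by module
      rw [this, h6, h7, sub_zero]
    exact (smul_eq_zero.1 h8).resolve_left (by simpa using h0)

/-- The element `X₀₀ v - [X, v]`, whose coordinates are those of `v` acted upon by the middle
block of `X`. -/
noncomputable def twist (X v : Mat (m + 2) F) : Mat (m + 2) F :=
  RCLike.re (X 0 0) • v - (X * v - v * X)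

/-- In the columns concerned `v` is supported in its first row, so there `Xv` contributes only `X 0
0` times that row. This cancels in `twist`, leaving `vX`, the first row of `v` times the middle
block of `X`. -/
lemma coord_twist {X v : Mat (m + 2) F} (hX : IsBorel X) (hv : IsHeis v) :
    coord (twist X v) = act X (coord v) := by
  have hs : ∀ z : F, RCLike.re (X 0 0) • z = X 0 0 * z := fun z => by
    rw [RCLike.real_smul_eq_coe_mul, hX.coe_re]
  rw [coord_apply, act_apply, coord_apply]
  refine Prod.ext ?_ (Prod.ext (funext fun j => ?_) ?_) <;>
  simp [twist, Matrix.mul_apply, sum_index, hs, hv.zero_zero, hv.one_one, hv.one_md,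
    hv.one_pn, hv.md_md, hv.md_one, hv.md_pn, hv.pn_pn, hv.pn_one, hv.pn_md, hv.pl_pn, hv.pl_one,
    hv.pl_md, hX.md_one, hX.md_md, hX.md_pn, hX.pn_pn, hX.pn_one, hX.pn_md, hX.pl_pn,
    hX.pl_one, hX.pl_md, Finset.sum_neg_distrib]
  ring

/-- The invariance that `act_eq_zero` needs rests on this stability of the ideal. The Borel property
is supplied separately by membership in the Lie algebra. -/
lemma IsHeis.of_twist {X v : Mat (m + 2) F} (hX : IsBorel X) (hv : IsHeis v)
    (hb : IsBorel (twist X v)) : IsHeis (twist X v) := by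
  refine { hb with zero_zero := ?_, one_one := ?_, one_md := fun j => ?_, one_pn := ?_ } <;>
  simp [twist, Matrix.mul_apply, sum_index, hv.zero_zero, hv.one_one, hv.one_md,
    hv.one_pn, hv.one_zero, hv.md_md, hv.md_one, hv.md_pn, hv.pn_pn, hv.pn_one, hv.pn_md, hv.pl_pn,
    hv.pl_one, hv.pl_md, hX.one_zero, hX.md_zero, hX.pn_zero, hX.pl_zero, hv.md_zero, hv.pn_zero,
    hv.pl_zero, hX.pl_one, hX.pl_md, hX.pl_pn]

/-- Only the entry `(0, pl)` of `v * v` can be nonzero, and by skewness it is minus the value of the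
form. -/
lemma IsHeis.mul_self {v : Mat (m + 2) F} (hv : IsHeis v) (hQ : form (coord v) (coord v) = 0) :
    v * v = 0 := by
  have hsum : v 0 1 * v 1 pl + (∑ j, v 0 (md j) * v (md j) pl + v 0 pn * v pn pl) = 0 := by
    -- `form` records only a real part. The underlying sum is self-conjugate, so it vanishes in `F`
    -- as well.
    have hreal : star (∑ j, v 0 (md j) * star (v 0 (md j)) + v 0 1 * star (v 0 pn)
        + v 0 pn * star (v 0 1)) = ∑ j, v 0 (md j) * star (v 0 (md j)) + v 0 1 * star (v 0 pn)
        + v 0 pn * star (v 0 1) := by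
      simp only [star_add, star_sum, star_mul', star_star]
      rw [Finset.sum_congr rfl fun j _ => mul_comm _ _]
      ring
    have h0 := RCLike.conj_eq_iff_re.1 hreal
    have hQ' : RCLike.re (∑ j, v 0 (md j) * star (v 0 (md j)) + v 0 1 * star (v 0 pn)
        + v 0 pn * star (v 0 1)) = 0 := hQ
    rw [hQ', RCLike.ofReal_zero] at h0
    rw [hv.one_pl, hv.pn_pl]
    simp only [hv.md_pl, mul_neg, Finset.sum_neg_distrib]
    linear_combination h0
  ext i j
  rw [Matrix.mul_apply, Matrix.zero_apply]
  by_cases hi : i = 0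
  · by_cases hj : j = pl
    · subst hi hj
      rw [sum_index, hv.zero_zero, hv.pl_pl']
      linear_combination hsum
    · subst hi
      refine Finset.sum_eq_zero fun k _ => ?_
      by_cases hk : k = 0
      · rw [hk, hv.zero_zero, zero_mul]
      · rw [hv.eq_zero hk hj, mul_zero]
  · refine Finset.sum_eq_zero fun k _ => ?_
    by_cases hk : k = pl
    · subst hk
      have : v pl j = 0 := by
        by_cases hj : j = pl
        · rw [hj, hv.pl_pl']
        · exact hv.eq_zero (zero_lt_pl).ne' hj
      rw [this, mul_zero]
    · rw [hv.eq_zero hi hk, zero_mul]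

lemma normSqX_add_eq_form (v : Mat (m + 2) F) :
    normSqX v + 2 * RCLike.re (coordφ v * starRingEnd F (coordη v)) = form (coord v) (coord v) := by
  have h1 : normSqX v = RCLike.re (∑ j, v 0 (md j) * star (v 0 (md j))) := by
    rw [normSqX, Finset.sum_filter, sum_index, map_sum]
    have : ∀ z : F, RCLike.re (z * star z) = ‖z‖ ^ 2 := fun z => by
      rw [RCLike.star_def, RCLike.mul_conj, ← RCLike.ofReal_pow, RCLike.ofReal_re]
    simp only [this]
    simp [md, pn, pl]
  have h2 : RCLike.re (v 0 pn * star (v 0 1)) = RCLike.re (v 0 1 * star (v 0 pn)) := by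
    have : star (v 0 1 * star (v 0 pn)) = v 0 pn * star (v 0 1) := by
      rw [star_mul', star_star, mul_comm]
    rw [← this]
    exact RCLike.conj_re _
  have h3 : form (coord v) (coord v) = RCLike.re (∑ j, v 0 (md j) * star (v 0 (md j)) +
    v 0 1 * star (v 0 pn) + v 0 pn * star (v 0 1)) := rfl
  rw [h3, map_add, map_add, h2, h1]
  have h4 : RCLike.re (coordφ v * starRingEnd F (coordη v)) = RCLike.re (v 0 1 * star (v 0 pn)) :=
    rfl
  rw [h4]
  ring

end Coordinates

/-! ### The torus, and the passage from `AN` to upper triangular Lie algebra elements. -/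

section BorelSubgroup

variable {m : ℕ} {F : Type*} [RCLike F]

lemma mul_formJ_eq_of_mem_G {n : ℕ} {g : SL n F} (hg : g ∈ G n F) {M : Mat n F}
    (hM : M * (g : Mat n F) = 1) : formJ n F * (g : Mat n F)ᴴ = M * formJ n F := by
  have h : (g : Mat n F) * formJ n F * (g : Mat n F)ᴴ = formJ n F := hg
  calc formJ n F * (g : Mat n F)ᴴ = (M * (g : Mat n F)) * (formJ n F * (g : Mat n F)ᴴ) := by
        rw [hM, Matrix.one_mul]
    _ = M * ((g : Mat n F) * formJ n F * (g : Mat n F)ᴴ) := by simp only [Matrix.mul_assoc]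
    _ = M * formJ n F := by rw [h]

/-- The weights of the diagonal matrix `diag (s, t, 0, …, 0, -t, -s)`. -/
def wt (s t : ℝ) (i : Fin (m + 2 + 2)) : ℝ :=
  if i = 0 then s else if i = 1 then t else if i = pn then -t else if i = pl then -s else 0

@[simp] lemma wt_zero (s t : ℝ) : wt s t (0 : Fin (m + 2 + 2)) = s := by simp [wt]
@[simp] lemma wt_one (s t : ℝ) : wt s t (1 : Fin (m + 2 + 2)) = t := by simp [wt]
@[simp] lemma wt_pn (s t : ℝ) : wt s t (pn : Fin (m + 2 + 2)) = -t := by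
  rw [wt, if_neg zero_lt_pn.ne', if_neg one_lt_pn.ne', if_pos rfl]
@[simp] lemma wt_pl (s t : ℝ) : wt s t (pl : Fin (m + 2 + 2)) = -s := by
  rw [wt, if_neg zero_lt_pl.ne', if_neg one_lt_pl.ne', if_neg pn_lt_pl.ne', if_pos rfl]
@[simp] lemma wt_md (s t : ℝ) (j : Fin m) : wt s t (md j) = 0 := by
  rw [wt, if_neg (zero_lt_md j).ne', if_neg (one_lt_md j).ne', if_neg (md_lt_pn j).ne,
    if_neg (md_lt_pl j).ne]

lemma wt_flip (s t : ℝ) (i : Fin (m + 2 + 2)) : wt s t (flip i) = -wt s t i := by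
  induction i using index_cases <;> simp

/-- The element `diag (eˢ, eᵗ, 1, …, 1, e⁻ᵗ, e⁻ˢ)`. -/
noncomputable def torus (F : Type*) [RCLike F] (s t : ℝ) : SL (m + 2) F :=
  ⟨diagonal fun i => ((Real.exp (wt s t i) : ℝ) : F), by
    rw [det_diagonal, ← RCLike.ofReal_prod, ← Real.exp_sum, sum_index]
    simp⟩

lemma coe_torus (s t : ℝ) : ((torus F s t : SL (m + 2) F) : Mat (m + 2) F) =
    diagonal fun i => ((Real.exp (wt s t i) : ℝ) : F) := rfl

lemma diagonal_mem_G {d : Fin (m + 2 + 2) → ℝ} :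
    diagonal (fun i => (d i : F)) * formJ (m + 2) F * (diagonal (fun i => (d i : F)))ᴴ
      = formJ (m + 2) F ↔ ∀ i, d i * d (flip i) = 1 := by
  have e : ∀ i j, (diagonal (fun i => (d i : F)) * formJ (m + 2) F *
      (diagonal (fun i => (d i : F)))ᴴ) i j = d i * formJ (m + 2) F i j * d j := fun i j => by
    rw [diagonal_conjTranspose, mul_diagonal, diagonal_mul]
    simp
  constructor
  · intro h i
    have h1 := congrFun (congrFun h i) (flip i)
    rw [e, formJ_apply, if_pos rfl, mul_one] at h1
    exact_mod_cast h1
  · intro h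
    ext i j
    rw [e, formJ_apply]
    split_ifs with hj
    · subst hj
      rw [mul_one]
      exact_mod_cast h i
    · simp

lemma torus_mem_A (s t : ℝ) : (torus F s t : SL (m + 2) F) ∈ A (m + 2) F := by
  refine ⟨diagonal_mem_G.2 fun i => ?_, fun i => Real.exp (wt s t i),
    fun i => (Real.exp_pos _).le, rfl⟩
  rw [wt_flip, ← Real.exp_add, add_neg_cancel, Real.exp_zero]

lemma exists_torus_of_mem_A {a : SL (m + 2) F} (ha : a ∈ A (m + 2) F) :
    ∃ s t : ℝ, a = torus F s t := by
  obtain ⟨hG, d, hd, hda⟩ := ha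
  have hG' : (a : Mat (m + 2) F) * formJ (m + 2) F * (a : Mat (m + 2) F)ᴴ = formJ (m + 2) F := hG
  rw [hda, diagonal_mem_G] at hG'
  have hpos : ∀ i, 0 < d i := fun i => lt_of_le_of_ne (hd i) (by
    intro h; have := hG' i; rw [← h, zero_mul] at this; exact zero_ne_one this)
  refine ⟨Real.log (d 0), Real.log (d 1), Subtype.ext ?_⟩
  rw [hda, coe_torus]
  congr 1
  funext i
  congr 1
  induction i using index_cases with
  | h0 => simp [Real.exp_log (hpos 0)]
  | h1 => simp [Real.exp_log (hpos 1)]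
  | hm j =>
    have h1 := hG' (md j)
    rw [flip_md] at h1
    rw [wt_md, Real.exp_zero]
    nlinarith [hpos (md j)]
  | hn =>
    have h1 := hG' 1
    rw [flip_one] at h1
    rw [wt_pn, Real.exp_neg, Real.exp_log (hpos 1)]
    exact eq_inv_of_mul_eq_one_right h1
  | hl =>
    have h1 := hG' 0
    rw [flip_zero] at h1
    rw [wt_pl, Real.exp_neg, Real.exp_log (hpos 0)]
    exact eq_inv_of_mul_eq_one_right h1

lemma torus_inv (s t : ℝ) : (torus F s t : SL (m + 2) F)⁻¹ = torus F (-s) (-t) := by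
  rw [inv_eq_iff_mul_eq_one]
  apply Subtype.ext
  change ((torus F s t : SL (m + 2) F) : Mat (m + 2) F) *
    ((torus F (-s) (-t) : SL (m + 2) F) : Mat (m + 2) F) = 1
  rw [coe_torus, coe_torus, diagonal_mul_diagonal, ← diagonal_one]
  congr 1
  funext i
  rw [← RCLike.ofReal_mul, ← Real.exp_add]
  have : wt s t i + wt (-s) (-t) i = 0 := by
    induction i using index_cases <;> simp
  rw [this]; simp

lemma torus_blockTriangular (s t : ℝ) :
    ((torus F s t : SL (m + 2) F) : Mat (m + 2) F).BlockTriangular id :=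
  blockTriangular_diagonal _

/-- An element of `A N` is upper triangular, and its diagonal is that of its `A`-component. -/
lemma torus_mul_diag {s t : ℝ} {b : SL (m + 2) F} (hb : b ∈ N (m + 2) F) (i : Fin (m + 2 + 2)) :
    ((torus F s t * b : SL (m + 2) F) : Mat (m + 2) F) i i = ((Real.exp (wt s t i) : ℝ) : F) := by
  change (((torus F s t : SL (m + 2) F) : Mat (m + 2) F) * (b : Mat (m + 2) F)) i i = _
  rw [coe_torus, diagonal_mul, hb.2.2, mul_one]

lemma torus_mul_blockTriangular {s t : ℝ} {b : SL (m + 2) F} (hb : b ∈ N (m + 2) F) :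
    ((torus F s t * b : SL (m + 2) F) : Mat (m + 2) F).BlockTriangular id :=
  (torus_blockTriangular s t).mul hb.2.1

lemma torus_eq_of_diag {s t s' t' : ℝ} {b : SL (m + 2) F}
    (hb : b ∈ N (m + 2) F)
    (h0 : ((torus F s t * b : SL (m + 2) F) : Mat (m + 2) F) 0 0 = ((Real.exp s' : ℝ) : F))
    (h1 : ((torus F s t * b : SL (m + 2) F) : Mat (m + 2) F) 1 1 = ((Real.exp t' : ℝ) : F)) :
    s = s' ∧ t = t' := by
  rw [torus_mul_diag hb, wt_zero] at h0
  rw [torus_mul_diag hb, wt_one] at h1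
  exact ⟨Real.exp_injective (RCLike.ofReal_injective h0),
    Real.exp_injective (RCLike.ofReal_injective h1)⟩

/-- The middle block of an element of `N` is the identity matrix. -/
lemma N_md_md {b : SL (m + 2) F} (hb : b ∈ N (m + 2) F) (i j : Fin m) :
    (b : Mat (m + 2) F) (md i) (md j) = if i = j then 1 else 0 := by
  obtain ⟨hG, hu, hd⟩ := hb
  have hG' : (b : Mat (m + 2) F) * formJ (m + 2) F * (b : Mat (m + 2) F)ᴴ = formJ (m + 2) F := hG
  have h := congrFun (congrFun hG' (md i)) (md i)
  rw [Matrix.mul_apply] at h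
  simp only [mul_formJ_apply, conjTranspose_apply] at h
  have z0 : (b : Mat (m + 2) F) (md i) 0 = 0 := hu (zero_lt_md i)
  have z1 : (b : Mat (m + 2) F) (md i) 1 = 0 := hu (one_lt_md i)
  rw [sum_index, formJ_apply] at h
  simp only [flip_zero, flip_one, flip_md, flip_pn, flip_pl, z0, z1, star_zero, mul_zero, zero_mul,
    zero_add, add_zero, if_true] at h
  -- The middle block of `J` is the identity, so the rows of the middle block of `b` are unit
  -- vectors. The diagonal entry 1 leaves no room for others.
  have h2 : ∑ k, ‖(b : Mat (m + 2) F) (md i) (md k)‖ ^ 2 = 1 := by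
    have : ∀ z : F, z * star z = ((‖z‖ ^ 2 : ℝ) : F) := fun z => by
      rw [RCLike.star_def, RCLike.mul_conj, RCLike.ofReal_pow]
    simp only [this] at h
    exact_mod_cast h
  split_ifs with hij
  · rw [hij, hd]
  · by_contra hne
    have h3 := Finset.sum_le_sum_of_subset_of_nonneg
      (f := fun k => ‖(b : Mat (m + 2) F) (md i) (md k)‖ ^ 2) (Finset.subset_univ {i, j})
      fun _ _ _ => by positivity
    rw [Finset.sum_pair hij] at h3
    rw [h2, hd, norm_one] at h3
    have : 0 < ‖(b : Mat (m + 2) F) (md i) (md j)‖ ^ 2 := by positivity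
    linarith

lemma lieAlg_mono {n : ℕ} {H K : Subgroup (SL n F)} (h : H ≤ K) : lieAlg H ⊆ lieAlg K :=
  fun _ hX t => let ⟨g, hg, e⟩ := hX t; ⟨g, h hg, e⟩

variable {H : Subgroup (SL (m + 2) F)}

lemma exists_torus_mul_of_mem (hAN : (H : Set (SL (m + 2) F)) ⊆
      (A (m + 2) F : Set _) * (N (m + 2) F : Set _)) {h : SL (m + 2) F} (hh : h ∈ H) :
    ∃ s t : ℝ, ∃ b ∈ N (m + 2) F, h = torus F s t * b := by
  obtain ⟨a, ha, b, hb, rfl⟩ := hAN hh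
  obtain ⟨s, t, rfl⟩ := exists_torus_of_mem_A ha
  exact ⟨s, t, b, hb, rfl⟩

lemma A_le_G {n : ℕ} : A n F ≤ G n F := fun _ h => h.1
lemma N_le_G {n : ℕ} : N n F ≤ G n F := fun _ h => h.1

/-- Differentiate at `t = 0` the conditions that `exp(tX) ∈ AN` is upper triangular, has real
diagonal and preserves `J`. -/
lemma isBorel_of_mem_lieAlg (hAN : (H : Set (SL (m + 2) F)) ⊆
      (A (m + 2) F : Set _) * (N (m + 2) F : Set _)) {X : Mat (m + 2) F} (hX : X ∈ lieAlg H) :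
    IsBorel X := by
  have hγ : ∀ t : ℝ, ∃ h : SL (m + 2) F, h ∈ G (m + 2) F ∧
      NormedSpace.exp (t • X) = (h : Mat (m + 2) F) ∧
      (h : Mat (m + 2) F).BlockTriangular id ∧
      ∀ i, star ((h : Mat (m + 2) F) i i) = (h : Mat (m + 2) F) i i := fun t => by
    obtain ⟨h, hh, he⟩ := hX t
    obtain ⟨s, r, b, hb, rfl⟩ := exists_torus_mul_of_mem hAN hh
    refine ⟨_, mul_mem (A_le_G (torus_mem_A s r)) (N_le_G hb), he.symm,
      torus_mul_blockTriangular hb, fun i => ?_⟩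
    rw [torus_mul_diag hb]
    exact RCLike.conj_ofReal _
  refine ⟨fun i j hij => ?_, fun i => ?_, ?_⟩
  · have h1 := hasDerivAt_exp_entry X i j
    have h2 : (fun t : ℝ => NormedSpace.exp (t • X) i j) = fun _ => 0 := funext fun t => by
      obtain ⟨h, -, he, hu, -⟩ := hγ t
      rw [he]; exact hu hij
    rw [h2] at h1
    exact h1.unique (hasDerivAt_const _ _)
  · have h1 := hasDerivAt_exp_entry X i i
    have h2 : (fun t : ℝ => star (NormedSpace.exp (t • X) i i))
        = fun t : ℝ => NormedSpace.exp (t • X) i i := funext fun t => by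
      obtain ⟨h, -, he, -, hr⟩ := hγ t
      rw [he]; exact hr i
    have h3 := h1.star
    rw [h2] at h3
    exact h3.unique h1
  · intro i j
    have h1 := (hasDerivAt_exp_entry X (flip j) (flip i)).star
    have h2 := hasDerivAt_exp_entry (-X) i j
    have h4 : (fun t : ℝ => star (NormedSpace.exp (t • X) (flip j) (flip i)))
        = fun t : ℝ => NormedSpace.exp (t • (-X)) i j := funext fun t => by
      obtain ⟨h, hG, he, -, -⟩ := hγ t
      have e1 : NormedSpace.exp (t • (-X)) * (h : Mat (m + 2) F) = 1 := by
        rw [← he, smul_neg]; exact exp_neg_mul_exp _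
      have e2 := congrFun (congrFun (mul_formJ_eq_of_mem_G hG e1) i) (flip j)
      rw [formJ_mul_apply, mul_formJ_apply, conjTranspose_apply, flip_flip] at e2
      rw [he, e2]
    rw [h4] at h1
    have h3 := h1.unique h2
    rw [h3]; simp

lemma exp_diag_of_isBorel {X : Mat (m + 2) F} (hX : IsBorel X) (i : Fin (m + 2 + 2)) :
    NormedSpace.exp X i i = ((Real.exp (RCLike.re (X i i)) : ℝ) : F) := by
  rw [exp_diag_of_blockTriangular hX.upper, ← hX.coe_re, RCLike.ofReal_re, Real.exp_eq_exp_ℝ]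
  exact (NormedSpace.algebraMap_exp_comm (𝕂 := ℝ) (𝔸 := F) (RCLike.re (X i i))).symm

/-- The exponential of an element of the Lie algebra, in terms of its `A`-component. -/
lemma exists_exp_eq_torus_mul (hAN : (H : Set (SL (m + 2) F)) ⊆
      (A (m + 2) F : Set _) * (N (m + 2) F : Set _)) {X : Mat (m + 2) F} (hX : X ∈ lieAlg H) :
    ∃ h ∈ H, (h : Mat (m + 2) F) = NormedSpace.exp X ∧
      ∃ b ∈ N (m + 2) F, h = torus F (RCLike.re (X 0 0)) (RCLike.re (X 1 1)) * b := by
  obtain ⟨h, hh, he⟩ := hX 1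
  rw [one_smul] at he
  refine ⟨h, hh, he, ?_⟩
  have hB := isBorel_of_mem_lieAlg hAN hX
  obtain ⟨s, t, b, hb, rfl⟩ := exists_torus_mul_of_mem hAN hh
  obtain ⟨rfl, rfl⟩ := torus_eq_of_diag hb (by rw [he]; exact exp_diag_of_isBorel hB 0)
    (by rw [he]; exact exp_diag_of_isBorel hB 1)
  exact ⟨b, hb, rfl⟩

lemma torus_zero : (torus F 0 0 : SL (m + 2) F) = 1 := by
  apply Subtype.ext
  rw [coe_torus]
  change _ = (1 : Mat (m + 2) F)
  rw [← diagonal_one]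
  congr 1
  funext i
  have : wt 0 0 i = 0 := by induction i using index_cases <;> simp
  rw [this]; simp

/-- The diagonal of `exp(tX)` determines its `A`-component, which is trivial for all `t` exactly
when `X 0 0` and `X 1 1` vanish. -/
lemma mem_lieAlg_inf_N (hAN : (H : Set (SL (m + 2) F)) ⊆
      (A (m + 2) F : Set _) * (N (m + 2) F : Set _)) {X : Mat (m + 2) F} :
    X ∈ lieAlg (H ⊓ N (m + 2) F) ↔ X ∈ lieAlg H ∧ X 0 0 = 0 ∧ X 1 1 = 0 := by
  constructor
  · intro hX
    refine ⟨lieAlg_mono inf_le_left hX, ?_⟩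
    have key : ∀ i, X i i = 0 := fun i => by
      have h1 := hasDerivAt_exp_entry X i i
      have h2 : (fun t : ℝ => NormedSpace.exp (t • X) i i) = fun _ => 1 := funext fun t => by
        obtain ⟨h, hh, he⟩ := hX t
        rw [← he]; exact hh.2.2.2 i
      rw [h2] at h1
      exact h1.unique (hasDerivAt_const _ _)
    exact ⟨key 0, key 1⟩
  · rintro ⟨hX, h0, h1⟩ t
    have htX : t • X ∈ lieAlg H := by
      intro r
      rw [smul_smul]
      exact hX _
    obtain ⟨h, hh, he, b, hb, hbt⟩ := exists_exp_eq_torus_mul hAN htX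
    rw [Matrix.smul_apply, Matrix.smul_apply, h0, h1, smul_zero, map_zero, torus_zero,
      one_mul] at hbt
    exact ⟨h, ⟨hh, by rw [hbt]; exact hb⟩, he⟩

end BorelSubgroup

/-! ### Construction of nearly quadratic curves. -/

section Curves

variable {F : Type*} [RCLike F]

lemma norm_le_maxNorm {ι : Type*} [Finite ι] (M : Matrix ι ι F) (i j : ι) :
    ‖M i j‖ ≤ maxNorm M :=
  le_ciSup (f := fun p : ι × ι => ‖M p.1 p.2‖) (Set.finite_range _).bddAbove (i, j)

lemma maxNorm_nonneg {ι : Type*} (M : Matrix ι ι F) : 0 ≤ maxNorm M :=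
  Real.iSup_nonneg fun _ => norm_nonneg _

lemma maxNorm_le {ι : Type*} [Nonempty ι] {M : Matrix ι ι F} {c : ℝ} (h : ∀ i j, ‖M i j‖ ≤ c) :
    maxNorm M ≤ c :=
  ciSup_le fun p => h p.1 p.2

lemma maxNorm_rho_le {n : ℕ} (h : SL n F) : maxNorm (rho h) ≤ 2 * maxNorm h.1 ^ 2 := by
  refine maxNorm_le fun p q => ?_
  have e := norm_le_maxNorm h.1
  have hn := maxNorm_nonneg h.1
  rw [rho, det_fin_two_of, two_mul, pow_two]
  refine (norm_sub_le _ _).trans (add_le_add ?_ ?_) <;>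
  · rw [norm_mul]
    exact mul_le_mul (e _ _) (e _ _) (norm_nonneg _) hn

/-- Only the lower bound on `ρ` carries information: `‖ρ(h)‖ ≤ 2‖h‖²` always holds. -/
lemma hasNearlyQuadraticCurve_of_le {n : ℕ} {H : Subgroup (SL n F)} {h : ℝ → SL n F}
    (hc : Continuous h) (hH : ∀ t, h t ∈ H) (hlim : Tendsto (fun t => maxNorm (h t).1) atTop atTop)
    {c : ℝ} (hle : ∀ᶠ t in atTop, maxNorm (h t).1 ^ 2 ≤ c * maxNorm (rho (h t))) :
    HasNearlyQuadraticCurve H := by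
  refine ⟨h, hc, hH, hlim, ?_, ?_⟩
  · refine Asymptotics.IsBigO.of_bound 2 (Eventually.of_forall fun t => ?_)
    rw [Real.norm_of_nonneg (maxNorm_nonneg _), Real.norm_of_nonneg (sq_nonneg _)]
    exact maxNorm_rho_le _
  · refine Asymptotics.IsBigO.of_bound c ?_
    filter_upwards [hle] with t ht
    rwa [Real.norm_of_nonneg (maxNorm_nonneg _), Real.norm_of_nonneg (sq_nonneg _)]

variable {m : ℕ}

lemma continuous_torus_diag : Continuous fun t : ℝ => (torus F t t : SL (m + 2) F) := by
  refine SpecialLinearGroup.isClosedEmbedding_val.isEmbedding.continuous_iff.2 ?_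
  refine continuous_pi fun i => continuous_pi fun j => ?_
  have e : (fun t : ℝ => ((torus F t t : SL (m + 2) F) : Mat (m + 2) F) i j) =
      fun t => if i = j then ((Real.exp (wt t t i) : ℝ) : F) else 0 := by
    funext t
    rw [coe_torus, diagonal_apply]
  change Continuous fun t : ℝ => ((torus F t t : SL (m + 2) F) : Mat (m + 2) F) i j
  rw [e]
  split_ifs
  · refine RCLike.continuous_ofReal.comp (Real.continuous_exp.comp ?_)
    unfold wt
    split_ifs <;> fun_prop
  · exact continuous_const

/-- The subgroup `A` contains a curve along the wall `ker α`. -/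
lemma hasNearlyQuadraticCurve_of_torus {H : Subgroup (SL (m + 2) F)}
    (hH : ∀ t : ℝ, torus F t t ∈ H) : HasNearlyQuadraticCurve H := by
  have hentry : ∀ t : ℝ, ∀ i j, ((torus F t t : SL (m + 2) F) : Mat (m + 2) F) i j =
      if i = j then ((Real.exp (wt t t i) : ℝ) : F) else 0 := fun t i j => by
    rw [coe_torus, diagonal_apply]
  refine hasNearlyQuadraticCurve_of_le (h := fun t => torus F t t) (c := 1)
    continuous_torus_diag hH ?_ ?_
  · refine tendsto_atTop_mono (fun t => ?_) Real.tendsto_exp_atTop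
    have := norm_le_maxNorm (torus F t t : SL (m + 2) F).1 0 0
    rwa [hentry, if_pos rfl, wt_zero, RCLike.norm_ofReal, Real.abs_exp] at this
  · filter_upwards [eventually_ge_atTop 0] with t ht
    have h1 : maxNorm (torus F t t : SL (m + 2) F).1 ≤ Real.exp t := by
      refine maxNorm_le fun i j => ?_
      rw [hentry]
      split_ifs
      · rw [RCLike.norm_ofReal, Real.abs_exp, Real.exp_le_exp]
        induction i using index_cases <;> simp <;> linarith
      · rw [norm_zero]; exact (Real.exp_pos _).le
    -- The leading 2 × 2 minor is `e^{2t}`, the square of the largest entry.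
    have h2 := norm_le_maxNorm (rho (torus F t t : SL (m + 2) F)) (0, 1) (0, 1)
    rw [rho, det_fin_two_of] at h2
    simp only [hentry, if_neg zero_lt_one_index.ne, if_neg zero_lt_one_index.ne', mul_zero,
      sub_zero, if_true, wt_zero, wt_one, norm_mul, RCLike.norm_ofReal, Real.abs_exp] at h2
    have h3 := maxNorm_nonneg (torus F t t : SL (m + 2) F).1
    nlinarith [Real.exp_pos t]

/-- The isotropic elements of the ideal generate curves that stay near the wall `ker α`. -/
lemma hasNearlyQuadraticCurve_of_isHeis {H : Subgroup (SL (m + 2) F)} {v : Mat (m + 2) F}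
    (hvH : v ∈ lieAlg H) (hv : IsHeis v) (hQ : form (coord v) (coord v) = 0)
    (h0 : coord v ≠ 0) : HasNearlyQuadraticCurve H := by
  have hsq := hv.mul_self hQ
  choose h hhH hexp using hvH
  have hcoe : ∀ t : ℝ, (h t : Mat (m + 2) F) = 1 + t • v := fun t => by
    rw [hexp, exp_of_sq_zero]
    rw [Matrix.smul_mul, Matrix.mul_smul, hsq, smul_zero, smul_zero]
  have hentry : ∀ t : ℝ, ∀ i j, (h t : Mat (m + 2) F) i j =
      (if i = j then 1 else 0) + t * v i j := fun t i j => by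
    rw [hcoe, Matrix.add_apply, Matrix.one_apply, Matrix.smul_apply, RCLike.real_smul_eq_coe_mul]
  obtain ⟨k, hk0, hkl, hk⟩ : ∃ k, k ≠ 0 ∧ k ≠ pl ∧ v 0 k ≠ 0 := by
    by_contra! hcon
    apply h0
    rw [coord_apply, hcon 1 zero_lt_one_index.ne' one_lt_pl.ne,
      hcon pn zero_lt_pn.ne' pn_lt_pl.ne]
    exact Prod.ext rfl (Prod.ext (funext fun j => hcon (md j) (zero_lt_md j).ne' (md_lt_pl j).ne) rfl)
  have hfk : flip k ≠ pl := fun e => hk0 (by rw [← flip_flip k, e, flip_pl])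
  have hfk0 : flip k ≠ 0 := fun e => hkl (by rw [← flip_flip k, e, flip_zero])
  have hvk : v (flip k) pl = -star (v 0 k) := by rw [hv.skew, flip_pl, flip_flip]
  set a : ℝ := ‖v 0 k‖ with ha
  have hapos : 0 < a := norm_pos_iff.2 hk
  set b : ℝ := maxNorm v with hb
  have hbn : 0 ≤ b := maxNorm_nonneg v
  have hcont : Continuous h := by
    refine SpecialLinearGroup.isClosedEmbedding_val.isEmbedding.continuous_iff.2 ?_
    have : (Subtype.val ∘ h) = fun t : ℝ => NormedSpace.exp (t • v) := funext fun t => hexp t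
    exact this ▸ continuous_exp_smul v
  have hlow : ∀ t : ℝ, 0 ≤ t → t * a ≤ maxNorm (h t).1 := fun t ht => by
    have := norm_le_maxNorm (h t).1 0 k
    rwa [hentry, if_neg hk0.symm, zero_add, norm_mul, RCLike.norm_ofReal, abs_of_nonneg ht] at this
  have hup : ∀ t : ℝ, 1 ≤ t → maxNorm (h t).1 ≤ t * (1 + b) := fun t ht => by
    refine maxNorm_le fun i j => ?_
    rw [hentry]
    refine (norm_add_le _ _).trans ?_
    have h1 : ‖(if i = j then 1 else 0 : F)‖ ≤ 1 := by split_ifs <;> simp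
    have h2 : ‖(t : F) * v i j‖ ≤ t * b := by
      rw [norm_mul, RCLike.norm_ofReal, abs_of_nonneg (by linarith)]
      exact mul_le_mul_of_nonneg_left (norm_le_maxNorm v i j) (by linarith)
    linarith
  have hrho : ∀ t : ℝ, 1 ≤ t → t ^ 2 * a ^ 2 - t * b ≤ maxNorm (rho (h t)) := fun t ht => by
    -- Skewness gives `v (flip k) pl = -star (v 0 k)`, so one product in this minor has size `t² |v
    -- 0 k|²`, while the other is at most linear in `t`.
    have h1 := norm_le_maxNorm (rho (h t)) (0, flip k) (k, pl)
    rw [rho, det_fin_two_of] at h1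
    simp only [hentry, if_neg hk0.symm, if_neg hfk, if_neg zero_lt_pl.ne, zero_add, hvk,
      hv.eq_zero hfk0 hkl, mul_zero, add_zero] at h1
    have h2 : ‖(t : F) * v 0 k * (t * -star (v 0 k))‖ = t ^ 2 * a ^ 2 := by
      rw [norm_mul, norm_mul, norm_mul, norm_neg, norm_star, RCLike.norm_ofReal,
        abs_of_nonneg (by linarith)]
      ring
    have h3 : ‖(t : F) * v 0 pl * (if flip k = k then 1 else 0)‖ ≤ t * b := by
      rw [norm_mul, norm_mul, RCLike.norm_ofReal, abs_of_nonneg (by linarith)]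
      have h4 : ‖(if flip k = k then 1 else 0 : F)‖ ≤ 1 := by split_ifs <;> simp
      have h5 := norm_le_maxNorm v 0 pl
      calc t * ‖v 0 pl‖ * ‖(if flip k = k then 1 else 0 : F)‖ ≤ t * ‖v 0 pl‖ * 1 :=
            mul_le_mul_of_nonneg_left h4 (by positivity)
        _ ≤ t * b := by rw [mul_one]; exact mul_le_mul_of_nonneg_left h5 (by linarith)
    have h6 := norm_sub_norm_le ((t : F) * v 0 k * (t * -star (v 0 k)))
      ((t : F) * v 0 pl * (if flip k = k then 1 else 0))
    linarith
  refine hasNearlyQuadraticCurve_of_le (h := h) (c := 2 * (1 + b) ^ 2 / a ^ 2) hcont hhH ?_ ?_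
  · refine tendsto_atTop_mono' _ ?_ (tendsto_id.atTop_mul_const hapos)
    filter_upwards [eventually_ge_atTop 0] with t ht using hlow t ht
  -- Beyond `2b/a²` the linear error `tb` is at most half of `t² a²`.
  · filter_upwards [eventually_ge_atTop 1, eventually_ge_atTop (2 * b / a ^ 2)] with t ht htb
    rw [div_le_iff₀ (by positivity)] at htb
    have h1 : t ^ 2 * a ^ 2 / 2 ≤ maxNorm (rho (h t)) := by
      refine le_trans ?_ (hrho t ht)
      nlinarith
    have h2 : maxNorm (h t).1 ^ 2 ≤ (t * (1 + b)) ^ 2 :=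
      pow_le_pow_left₀ (maxNorm_nonneg _) (hup t ht) 2
    calc maxNorm (h t).1 ^ 2 ≤ (t * (1 + b)) ^ 2 := h2
      _ = 2 * (1 + b) ^ 2 / a ^ 2 * (t ^ 2 * a ^ 2 / 2) := by field_simp
      _ ≤ _ := mul_le_mul_of_nonneg_left h1 (by positivity)

end Curves

/-! ### The dimension count and the case of equality. -/

section Dimension

open Module

/-- Rank–nullity on a subspace, used to peel off one block of matrix entries at a time. -/
lemma finrank_eq_map_add_inf_ker {V W : Type*} [AddCommGroup V] [Module ℝ V]
    [FiniteDimensional ℝ V] [AddCommGroup W] [Module ℝ W] (K : Submodule ℝ V) (f : V →ₗ[ℝ] W) :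
    finrank ℝ K = finrank ℝ (K.map f) + finrank ℝ (K ⊓ f.ker : Submodule ℝ V) := by
  have h := (f.domRestrict K).finrank_range_add_finrank_ker
  rw [LinearMap.range_domRestrict] at h
  have e : Submodule.map K.subtype (f.domRestrict K).ker = K ⊓ f.ker := by
    ext x
    simp only [Submodule.mem_map, LinearMap.mem_ker, Submodule.mem_inf]
    constructor
    · rintro ⟨y, hy, rfl⟩
      exact ⟨y.2, hy⟩
    · rintro ⟨hx, hfx⟩
      exact ⟨⟨x, hx⟩, hfx, rfl⟩
  rw [← e, Submodule.finrank_map_subtype_eq]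
  exact h.symm

variable {m : ℕ} {F : Type*} [RCLike F]

instance : FiniteDimensional ℝ (Mat (m + 2) F) := Module.Finite.trans F _

/-- The purely imaginary scalars. -/
noncomputable def imag (F : Type*) [RCLike F] : Submodule ℝ F := (RCLike.reLm (K := F)).ker

lemma mem_imag {z : F} : z ∈ imag F ↔ RCLike.re z = 0 := Iff.rfl

lemma mem_imag_of_star_eq_neg {z : F} (h : star z = -z) : z ∈ imag F := by
  have h1 := congrArg RCLike.re h
  rw [RCLike.star_def, RCLike.conj_re, map_neg] at h1
  rw [mem_imag]
  linarith

lemma finrank_imag_add_one : finrank ℝ (imag F) + 1 = finrank ℝ F := by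
  have h := (RCLike.reLm (K := F)).finrank_range_add_finrank_ker
  have hs : (RCLike.reLm (K := F)).range = ⊤ :=
    LinearMap.range_eq_top.2 fun r => ⟨(r : F), RCLike.ofReal_re r⟩
  rw [hs, finrank_top, finrank_self] at h
  rw [imag]
  omega

/-- The entry in a fixed row and column. -/
noncomputable def entry (i j : Fin (m + 2 + 2)) : Mat (m + 2) F →ₗ[ℝ] F where
  toFun X := X i j
  map_add' _ _ := rfl
  map_smul' _ _ := rfl

/-- The entries of a fixed row in the middle columns. -/
noncomputable def rowMd (i : Fin (m + 2 + 2)) : Mat (m + 2) F →ₗ[ℝ] (Fin m → F) where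
  toFun X j := X i (md j)
  map_add' _ _ := rfl
  map_smul' _ _ := rfl

/-- The `𝔞`-component of a Borel element. -/
noncomputable def diagPart : Mat (m + 2) F →ₗ[ℝ] ℝ × ℝ :=
  (RCLike.reLm ∘ₗ entry 0 0).prod (RCLike.reLm ∘ₗ entry 1 1)

/-- The coordinates `(x, η)`. -/
noncomputable def coordXη : Mat (m + 2) F →ₗ[ℝ] (Fin m → F) × F := (rowMd 0).prod (entry 0 pn)

lemma finrank_fin_fun' : finrank ℝ (Fin m → F) = finrank ℝ F * m := by
  rw [finrank_pi_fintype, Finset.sum_const, Finset.card_univ, Fintype.card_fin, smul_eq_mul,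
    mul_comm]

/-- The elements of a space of Borel elements that are nilpotent. -/
noncomputable def nilPart (L : Submodule ℝ (Mat (m + 2) F)) : Submodule ℝ (Mat (m + 2) F) :=
  L ⊓ diagPart.ker

/-- The elements of a space of Borel elements that satisfy `IsHeis`. -/
noncomputable def heisPart (L : Submodule ℝ (Mat (m + 2) F)) : Submodule ℝ (Mat (m + 2) F) :=
  (nilPart L ⊓ (rowMd 1).ker) ⊓ (entry 1 pn).ker

variable {L : Submodule ℝ (Mat (m + 2) F)}

lemma mem_nilPart (hL : ∀ X ∈ L, IsBorel X) {X : Mat (m + 2) F} :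
    X ∈ nilPart L ↔ X ∈ L ∧ X 0 0 = 0 ∧ X 1 1 = 0 := by
  constructor
  · rintro ⟨hX, h⟩
    have h1 : RCLike.re (X 0 0) = 0 := congrArg Prod.fst h
    have h2 : RCLike.re (X 1 1) = 0 := congrArg Prod.snd h
    refine ⟨hX, ?_, ?_⟩
    · rw [← (hL X hX).coe_re, h1, RCLike.ofReal_zero]
    · rw [← (hL X hX).coe_re, h2, RCLike.ofReal_zero]
  · rintro ⟨hX, h0, h1⟩
    refine ⟨hX, ?_⟩
    change (RCLike.re (X 0 0), RCLike.re (X 1 1)) = (0 : ℝ × ℝ)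
    rw [h0, h1, map_zero]
    rfl

lemma mem_heisPart (hL : ∀ X ∈ L, IsBorel X) {X : Mat (m + 2) F} :
    X ∈ heisPart L ↔ X ∈ L ∧ IsHeis X := by
  constructor
  · rintro ⟨⟨hX, hy⟩, hz⟩
    obtain ⟨hXL, h0, h1⟩ := (mem_nilPart hL).1 hX
    exact ⟨hXL, { hL X hXL with
      zero_zero := h0, one_one := h1, one_md := fun j => congrFun hy j, one_pn := hz }⟩
  · rintro ⟨hX, h⟩
    exact ⟨⟨(mem_nilPart hL).2 ⟨hX, h.zero_zero, h.one_one⟩, funext h.one_md⟩, h.one_pn⟩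

/-- The subspace contains no isotropic elements of the ideal except in `𝔫_{2α+2β}`. -/
def IsAnisotropic (L : Submodule ℝ (Mat (m + 2) F)) : Prop :=
  ∀ v ∈ L, IsHeis v → form (coord v) (coord v) = 0 → coord v = 0

lemma IsHeis.eq_zero_of_coord_eq_zero {v : Mat (m + 2) F} (hh : IsHeis v) (hc : coord v = 0)
    (h0 : v 0 pl = 0) : v = 0 := by
  have hrow : ∀ j, v 0 j = 0 := fun j => by
    induction j using index_cases with
    | h0 => exact hh.zero_zero
    | h1 => exact congrArg Prod.fst hc
    | hm j => exact congrFun (congrArg (fun p : Coord m F => p.2.1) hc) j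
    | hn => exact congrArg (fun p : Coord m F => p.2.2) hc
    | hl => exact h0
  ext i j
  change v i j = 0
  by_cases hi : i = 0
  · rw [hi]; exact hrow j
  by_cases hj : j = pl
  · rw [hj, hh.skew, flip_pl, hrow, star_zero, neg_zero]
  · exact hh.eq_zero hi hj

/-- Only the corner entry `(0, pl)` determines such a matrix, and skewness makes it purely
imaginary. -/
lemma finrank_le_of_coord_eq_zero (K : Submodule ℝ (Mat (m + 2) F))
    (hK : ∀ v ∈ K, IsHeis v ∧ coord v = 0) : finrank ℝ K ≤ finrank ℝ (imag F) := by
  refine LinearMap.finrank_le_finrank_of_injective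
    (f := ((entry 0 pl).domRestrict K).codRestrict (imag F) fun v =>
      mem_imag_of_star_eq_neg (hK v v.2).1.star_zero_pl) ?_
  rw [← LinearMap.ker_eq_bot, LinearMap.ker_eq_bot']
  intro v hv
  have h0 : (v : Mat (m + 2) F) 0 pl = 0 := congrArg Subtype.val hv
  obtain ⟨hh, hc⟩ := hK v v.2
  exact Subtype.ext (hh.eq_zero_of_coord_eq_zero hc h0)

/-- When `x = 0` and `η = 0` the form vanishes whatever `φ` is, so anisotropy forces `φ = 0`. -/
lemma coord_eq_zero_of_coordXη (hL : ∀ X ∈ L, IsBorel X) (han : IsAnisotropic L)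
    {v : Mat (m + 2) F} (hv : v ∈ heisPart L ⊓ (coordXη (m := m) (F := F)).ker) :
    IsHeis v ∧ coord v = 0 := by
  obtain ⟨h1, h2⟩ := hv
  obtain ⟨hvL, hh⟩ := (mem_heisPart hL).1 h1
  refine ⟨hh, han v hvL hh ?_⟩
  have hx : ∀ j, v 0 (md j) = 0 := fun j => congrFun (congrArg Prod.fst h2) j
  have hn : v 0 pn = 0 := congrArg Prod.snd h2
  simp [form, coord_apply, hx, hn]

/-- The action of the middle block of `L` kills the coordinates of its ideal part. -/
lemma act_coord_eq_zero (hL : ∀ X ∈ L, IsBorel X) (hbr : ∀ X ∈ L, ∀ Y ∈ L, X * Y - Y * X ∈ L)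
    (han : IsAnisotropic L) {X v : Mat (m + 2) F} (hX : X ∈ L) (hv : v ∈ heisPart L) :
    act X (coord v) = 0 := by
  refine act_eq_zero (hL X hX) ((heisPart L).map coord) ?_ ?_ (Submodule.mem_map_of_mem hv)
  · rintro _ ⟨w, hw, rfl⟩
    obtain ⟨hwL, hwh⟩ := (mem_heisPart hL).1 hw
    have ht : twist X w ∈ L := L.sub_mem (L.smul_mem _ hwL) (hbr X hX w hwL)
    rw [← coord_twist (hL X hX) hwh]
    exact Submodule.mem_map_of_mem
      ((mem_heisPart hL).2 ⟨ht, hwh.of_twist (hL X hX) (hL _ ht)⟩)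
  · rintro _ ⟨w, hw, rfl⟩ h
    obtain ⟨hwL, hwh⟩ := (mem_heisPart hL).1 hw
    exact han w hwL hwh h

lemma finrank_nilPart_eq :
    finrank ℝ (nilPart L) = finrank ℝ ((nilPart L).map (rowMd 1)) +
      (finrank ℝ ((nilPart L ⊓ (rowMd 1).ker).map (entry 1 pn)) + finrank ℝ (heisPart L)) := by
  rw [finrank_eq_map_add_inf_ker (nilPart L) (rowMd 1),
    finrank_eq_map_add_inf_ker (nilPart L ⊓ (rowMd 1).ker) (entry 1 pn), heisPart]

lemma finrank_heisPart_eq :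
    finrank ℝ (heisPart L) = finrank ℝ ((heisPart L).map coordXη) +
      finrank ℝ (heisPart L ⊓ (coordXη (m := m) (F := F)).ker : Submodule ℝ _) :=
  finrank_eq_map_add_inf_ker _ _

lemma finrank_map_coordXη_le :
    finrank ℝ ((heisPart L).map coordXη) ≤ finrank ℝ F * m + finrank ℝ F := by
  refine (Submodule.finrank_le _).trans ?_
  rw [finrank_prod, finrank_fin_fun']

/-- A nilpotent `X` outside the ideal kills the coordinates of the ideal part, which forces `φ = 0`
there. Then `x` alone determines the coordinates, and the possible `x` are orthogonal to the middle
entries of row 1 of `nilPart L`. The two families of row vectors share the dimension `dm`; the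
entries `(1, pn)` and `(0, pl)` add at most `d - 1` each. -/
lemma finrank_nilPart_add_two_le (hL : ∀ X ∈ L, IsBorel X)
    (hbr : ∀ X ∈ L, ∀ Y ∈ L, X * Y - Y * X ∈ L) (han : IsAnisotropic L)
    {X : Mat (m + 2) F} (hX : X ∈ nilPart L) (hXh : ¬ IsHeis X) :
    finrank ℝ (nilPart L) + 2 ≤ finrank ℝ F * (m + 2) := by
  have hmem : ∀ {Y}, Y ∈ nilPart L → Y ∈ L := fun hY => hY.1
  have hact : ∀ {Y v}, Y ∈ nilPart L → v ∈ heisPart L → act Y (coord v) = 0 :=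
    fun hY hv => act_coord_eq_zero hL hbr han (hmem hY) hv
  obtain ⟨-, hX0, hX1⟩ := (mem_nilPart hL).1 hX
  have hφ : ∀ v ∈ heisPart L, v 0 1 = 0 := by
    intro v hv
    have h := hact hX hv
    rw [act_apply, coord_apply] at h
    have hy : ∀ j, v 0 1 * X 1 (md j) = 0 := fun j =>
      congrFun (congrArg (fun p : Coord m F => p.2.1) h) j
    have hz : v 0 1 * X 1 pn - ∑ j, v 0 (md j) * star (X 1 (md j)) - v 0 pn * X 1 1 = 0 :=
      congrArg (fun p : Coord m F => p.2.2) h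
    -- If `φ ≠ 0`, the vanishing of the action makes the remaining entries of row 1 of the middle
    -- block of `X` zero, so `X` would lie in the ideal.
    by_contra hne
    have hy' : ∀ j, X 1 (md j) = 0 := fun j => (mul_eq_zero.1 (hy j)).resolve_left hne
    simp only [hy', hX1, star_zero, mul_zero, Finset.sum_const_zero, sub_zero] at hz
    exact hXh { hL X (hmem hX) with
      zero_zero := hX0, one_one := hX1, one_md := hy',
      one_pn := (mul_eq_zero.1 hz).resolve_left hne }
  have horth : ∀ Y ∈ nilPart L, ∀ v ∈ heisPart L, ∑ j, v 0 (md j) * star (Y 1 (md j)) = 0 := by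
    intro Y hY v hv
    have h := hact hY hv
    rw [act_apply, coord_apply] at h
    have hz : v 0 1 * Y 1 pn - ∑ j, v 0 (md j) * star (Y 1 (md j)) - v 0 pn * Y 1 1 = 0 :=
      congrArg (fun p : Coord m F => p.2.2) h
    rw [hφ v hv, ((mem_nilPart hL).1 hY).2.2] at hz
    simpa using hz
  have hdisj : Disjoint ((nilPart L).map (rowMd 1)) ((heisPart L).map (rowMd 0)) := by
    rw [Submodule.disjoint_def]
    rintro x ⟨Y, hY, hYx⟩ ⟨v, hv, hvx⟩
    have h := horth Y hY v hv
    have h1 : ∀ j, Y 1 (md j) = x j := fun j => congrFun hYx j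
    have h2 : ∀ j, v 0 (md j) = x j := fun j => congrFun hvx j
    simp only [h1, h2] at h
    have hn : ∀ z : F, z * star z = ((‖z‖ ^ 2 : ℝ) : F) := fun z => by
      rw [RCLike.star_def, RCLike.mul_conj, RCLike.ofReal_pow]
    simp only [hn] at h
    have h' : ∑ j, ‖x j‖ ^ 2 = 0 := by exact_mod_cast h
    rw [Finset.sum_eq_zero_iff_of_nonneg fun _ _ => by positivity] at h'
    funext j
    simpa using h' j (Finset.mem_univ j)
  have h1 : finrank ℝ ((nilPart L).map (rowMd 1)) + finrank ℝ ((heisPart L).map (rowMd 0))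
      ≤ finrank ℝ F * m := by
    rw [← finrank_fin_fun']
    exact Submodule.finrank_add_finrank_le_of_disjoint hdisj
  have h2 : finrank ℝ ((nilPart L ⊓ (rowMd 1).ker).map (entry 1 pn)) ≤ finrank ℝ (imag F) := by
    refine Submodule.finrank_mono ?_
    rintro _ ⟨Y, hY, rfl⟩
    exact mem_imag_of_star_eq_neg (hL Y (hmem hY.1)).star_one_pn
  have h3 : finrank ℝ (heisPart L ⊓ (rowMd 0).ker : Submodule ℝ (Mat (m + 2) F))
      ≤ finrank ℝ (imag F) := by
    refine finrank_le_of_coord_eq_zero _ ?_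
    rintro v ⟨hv, hx⟩
    obtain ⟨hvL, hh⟩ := (mem_heisPart hL).1 hv
    refine ⟨hh, han v hvL hh ?_⟩
    have hx' : ∀ j, v 0 (md j) = 0 := fun j => congrFun hx j
    simp [form, coord_apply, hx', hφ v hv]
  have h4 := finrank_eq_map_add_inf_ker (heisPart L) (rowMd 0)
  have h5 := finrank_nilPart_eq (L := L)
  have h6 := finrank_imag_add_one (F := F)
  have h7 : finrank ℝ F * (m + 2) = finrank ℝ F * m + finrank ℝ F * 2 := mul_add _ _ _
  omega

lemma nilPart_eq_heisPart (hL : ∀ X ∈ L, IsBorel X) (h : ∀ X ∈ nilPart L, IsHeis X) :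
    nilPart L = heisPart L :=
  le_antisymm (fun X hX => (mem_heisPart hL).2 ⟨hX.1, h X hX⟩) fun _ hX => hX.1.1

/-- The pair `(x, η)` contributes at most `dm + d`, and its kernel has only the imaginary corner
entry, of dimension at most `d - 1`. -/
lemma finrank_heisPart_add_one_le (hL : ∀ X ∈ L, IsBorel X) (han : IsAnisotropic L) :
    finrank ℝ (heisPart L) + 1 ≤ finrank ℝ F * (m + 2) := by
  have h1 := finrank_heisPart_eq (L := L)
  have h2 := finrank_map_coordXη_le (L := L)
  have h3 := finrank_le_of_coord_eq_zero _ fun v hv => coord_eq_zero_of_coordXη hL han hv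
  have h6 := finrank_imag_add_one (F := F)
  have h7 : finrank ℝ F * (m + 2) = finrank ℝ F * m + finrank ℝ F * 2 := mul_add _ _ _
  omega

lemma finrank_eq_diagPart_add : finrank ℝ L = finrank ℝ (L.map diagPart) + finrank ℝ (nilPart L) :=
  finrank_eq_map_add_inf_ker _ _

lemma finrank_le_of_diagPart_le (hL : ∀ X ∈ L, IsBorel X)
    (hbr : ∀ X ∈ L, ∀ Y ∈ L, X * Y - Y * X ∈ L) (han : IsAnisotropic L)
    (hdiag : finrank ℝ (L.map diagPart) ≤ 1) : finrank ℝ L ≤ finrank ℝ F * (m + 2) := by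
  have h1 := finrank_eq_diagPart_add (L := L)
  by_cases h : ∀ X ∈ nilPart L, IsHeis X
  · have h2 := finrank_heisPart_add_one_le hL han
    rw [← nilPart_eq_heisPart hL h] at h2
    omega
  · push Not at h
    obtain ⟨X, hX, hXh⟩ := h
    have := finrank_nilPart_add_two_le hL hbr han hX hXh
    omega

/-- The structure of the Lie algebras of maximal dimension. -/
lemma structure_of_finrank_eq (hL : ∀ X ∈ L, IsBorel X)
    (hbr : ∀ X ∈ L, ∀ Y ∈ L, X * Y - Y * X ∈ L) (han : IsAnisotropic L)
    (hdiag : finrank ℝ (L.map diagPart) ≤ 1) (heq : finrank ℝ L = finrank ℝ F * (m + 2)) :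
    (∀ X ∈ nilPart L, IsHeis X) ∧ (∃ X ∈ L, diagPart X ≠ 0) ∧
    (∀ X ∈ L, X 1 1 = 0 ∧ (∀ j, X 1 (md j) = 0) ∧ X 1 pn = 0) ∧
    ∀ z ∈ imag F, ∃ v ∈ L, IsHeis v ∧ coord v = 0 ∧ v 0 pl = z := by
  have h1 := finrank_eq_diagPart_add (L := L)
  have hall : ∀ X ∈ nilPart L, IsHeis X := by
    by_contra! h
    obtain ⟨X, hX, hXh⟩ := h
    have := finrank_nilPart_add_two_le hL hbr han hX hXh
    omega
  have e := nilPart_eq_heisPart hL hall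
  have h2 := finrank_heisPart_add_one_le hL han
  rw [← e] at h2
  have h3 := finrank_heisPart_eq (L := L)
  have h4 := finrank_map_coordXη_le (L := L)
  have h5 := finrank_le_of_coord_eq_zero _ fun v hv => coord_eq_zero_of_coordXη hL han hv
  have h6 := finrank_imag_add_one (F := F)
  have h7 : finrank ℝ F * (m + 2) = finrank ℝ F * m + finrank ℝ F * 2 := mul_add _ _ _
  rw [← e] at h3 h4 h5
  refine ⟨hall, ?_, ?_, ?_⟩
  · by_contra! h
    have : L.map diagPart = ⊥ := by
      rw [eq_bot_iff]
      rintro _ ⟨X, hX, rfl⟩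
      exact h X hX
    rw [this, finrank_bot] at h1
    omega
  -- The diagonal contributes at most 1, so equality makes every bound for `heisPart` sharp: all
  -- `(x, η)` occur, and the corner entries fill `imag F`.
  · have htop : (nilPart L).map coordXη = ⊤ := by
      refine Submodule.eq_top_of_finrank_eq ?_
      rw [finrank_prod, finrank_fin_fun']
      omega
    -- With `x = 0` and `η = 1`, anisotropy forces `φ ≠ 0`; this one vector, killed by every `act
    -- X`, detects the whole row 1 of the middle block.
    obtain ⟨v, hv, hvx⟩ : ((0, 1) : (Fin m → F) × F) ∈ (nilPart L).map coordXη := by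
      rw [htop]; trivial
    rw [e] at hv
    have hx : ∀ j, v 0 (md j) = 0 := fun j => congrFun (congrArg Prod.fst hvx) j
    have hn : v 0 pn = 1 := congrArg Prod.snd hvx
    have hφ : v 0 1 ≠ 0 := by
      intro h0
      obtain ⟨hvL, hh⟩ := (mem_heisPart hL).1 hv
      have hc := han v hvL hh (by simp [form, coord_apply, hx, h0])
      have : v 0 pn = 0 := congrArg (fun p : Coord m F => p.2.2) hc
      rw [hn] at this
      exact one_ne_zero this
    intro X hX
    have h := act_coord_eq_zero hL hbr han hX hv
    rw [act_apply, coord_apply] at h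
    have ht : v 0 1 * X 1 1 = 0 := congrArg Prod.fst h
    have hy : ∀ j, v 0 1 * X 1 (md j) = 0 := fun j =>
      congrFun (congrArg (fun p : Coord m F => p.2.1) h) j
    have hz : v 0 1 * X 1 pn - ∑ j, v 0 (md j) * star (X 1 (md j)) - v 0 pn * X 1 1 = 0 :=
      congrArg (fun p : Coord m F => p.2.2) h
    have h11 : X 1 1 = 0 := (mul_eq_zero.1 ht).resolve_left hφ
    refine ⟨h11, fun j => (mul_eq_zero.1 (hy j)).resolve_left hφ, ?_⟩
    simp only [hx, h11, zero_mul, mul_zero, Finset.sum_const_zero, sub_zero] at hz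
    exact (mul_eq_zero.1 hz).resolve_left hφ
  · set K : Submodule ℝ (Mat (m + 2) F) :=
      nilPart L ⊓ (coordXη (m := m) (F := F)).ker with hK
    have hKc : ∀ v ∈ K, IsHeis v ∧ coord v = 0 := fun v hv =>
      coord_eq_zero_of_coordXη hL han (by rw [← e]; exact hv)
    have hker : K ⊓ (entry 0 pl).ker = ⊥ := by
      rw [eq_bot_iff]
      rintro v ⟨hv, hv0⟩
      obtain ⟨hh, hc⟩ := hKc v hv
      exact hh.eq_zero_of_coord_eq_zero hc hv0
    have h8 := finrank_eq_map_add_inf_ker K (entry 0 pl)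
    rw [hker, finrank_bot] at h8
    have hle : K.map (entry 0 pl) ≤ imag F := by
      rintro _ ⟨v, hv, rfl⟩
      exact mem_imag_of_star_eq_neg (hKc v hv).1.star_zero_pl
    have himg : K.map (entry 0 pl) = imag F :=
      Submodule.eq_of_le_of_finrank_le hle (by omega)
    intro z hz
    rw [← himg] at hz
    obtain ⟨v, hv, hvz⟩ := hz
    exact ⟨v, hv.1.1, (hKc v hv).1, (hKc v hv).2, hvz⟩

end Dimension

/-! ### Root spaces in terms of matrix entries. -/

section RootSpaces

variable {m : ℕ} {F : Type*} [RCLike F]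

lemma wt_eq (s t : ℝ) (i : Fin (m + 2 + 2)) : wt s t i = s * wt 1 0 i + t * wt 0 1 i := by
  induction i using index_cases <;> simp

lemma conj_torus_apply (s t : ℝ) (X : Mat (m + 2) F) (i j : Fin (m + 2 + 2)) :
    (((torus F s t : SL (m + 2) F) : Mat (m + 2) F) * X *
      (((torus F s t : SL (m + 2) F)⁻¹ : SL (m + 2) F) : Mat (m + 2) F)) i j =
      ((Real.exp (wt s t i - wt s t j) : ℝ) : F) * X i j := by
  have h : wt (-s) (-t) j = -wt s t j := by induction j using index_cases <;> simp
  rw [torus_inv, coe_torus, coe_torus, mul_diagonal, diagonal_mul, h, sub_eq_add_neg,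
    Real.exp_add, RCLike.ofReal_mul]
  ring

lemma rootα_torus (s t : ℝ) :
    rootα (torus F s t : SL (m + 2) F) = ((Real.exp (s - t) : ℝ) : F) := by
  rw [rootα, coe_torus, diagonal_apply_eq, diagonal_apply_eq, wt_zero, wt_one, Real.exp_sub,
    RCLike.ofReal_div]

lemma rootβ_torus (s t : ℝ) : rootβ (torus F s t : SL (m + 2) F) = ((Real.exp t : ℝ) : F) := by
  rw [rootβ, coe_torus, diagonal_apply_eq, wt_one]

lemma root_torus (s t : ℝ) (p q : ℕ) :
    rootα (torus F s t : SL (m + 2) F) ^ p * rootβ (torus F s t : SL (m + 2) F) ^ q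
      = ((Real.exp (p * (s - t) + q * t) : ℝ) : F) := by
  rw [rootα_torus, rootβ_torus, Real.exp_add, Real.exp_nat_mul, Real.exp_nat_mul]
  push_cast
  rfl

/-- The entries of `X` of weight `pα + qβ`, all other entries being replaced by zero. -/
noncomputable def comp (p q : ℕ) (X : Mat (m + 2) F) : Mat (m + 2) F := fun i j =>
  open Classical in
  if wt 1 0 i - wt 1 0 j = p ∧ wt 0 1 i - wt 0 1 j = q - p then X i j else 0

/-- On `torus s t` the root `pα + qβ` has exponent `ps + (q - p)t`. Since `flip` negates weights,
selecting entries by weight preserves skewness. A nonzero root excludes the diagonal, so the trace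
is zero. -/
lemma comp_mem_rootSpace {p q : ℕ} (hpq : p ≠ 0 ∨ q ≠ 0) {X : Mat (m + 2) F} (hX : IsBorel X) :
    comp p q X ∈ rootSpace (m + 2) F p q := by
  refine ⟨⟨?_, ?_⟩, fun a ha => ?_⟩
  · refine Finset.sum_eq_zero fun i _ => ?_
    rw [diag_apply, comp, if_neg]
    rintro ⟨h1, h2⟩
    rw [sub_self] at h1 h2
    have hp : p = 0 := by exact_mod_cast h1.symm
    have hq : q = 0 := by
      rw [hp, Nat.cast_zero, sub_zero] at h2
      exact_mod_cast h2.symm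
    omega
  · rw [mul_formJ_add_iff]
    intro i j
    simp only [comp, wt_flip]
    by_cases h : wt 1 0 i - wt 1 0 j = p ∧ wt 0 1 i - wt 0 1 j = q - p
    · rw [if_pos h, if_pos ⟨by linarith [h.1], by linarith [h.2]⟩]
      exact hX.skew i j
    · rw [if_neg h, if_neg, star_zero, neg_zero]
      rintro ⟨h1, h2⟩
      exact h ⟨by linarith, by linarith⟩
  · obtain ⟨s, t, rfl⟩ := exists_torus_of_mem_A ha
    ext i j
    rw [conj_torus_apply, root_torus, Matrix.smul_apply, smul_eq_mul]
    by_cases h : wt 1 0 i - wt 1 0 j = p ∧ wt 0 1 i - wt 0 1 j = q - p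
    · congr 3
      rw [wt_eq s t i, wt_eq s t j]
      linear_combination s * h.1 + t * h.2
    · rw [comp, if_neg h, mul_zero, mul_zero]

/-- Elements of `𝔫_{2α+2β}` have a single nonzero entry. -/
lemma isHeis_of_mem_rootSpace_two_two {X : Mat (m + 2) F} (hX : X ∈ rootSpace (m + 2) F 2 2) :
    IsHeis X ∧ coord X = 0 := by
  obtain ⟨hsu, hroot⟩ := hX
  have hskew := mul_formJ_add_iff.1 hsu.2
  -- Conjugation by `torus 1 0` suffices: its weights are `1, 0, …, 0, -1`, and only the corner has
  -- weight difference 2.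
  have hz : ∀ i j : Fin (m + 2 + 2), (wt 1 0 i - wt 1 0 j ≠ 2) → X i j = 0 := fun i j hij => by
    have h := congrFun (congrFun (hroot _ (torus_mem_A 1 0)) i) j
    rw [conj_torus_apply, root_torus, Matrix.smul_apply, smul_eq_mul] at h
    by_contra hne
    have h1 := RCLike.ofReal_injective (mul_right_cancel₀ hne h)
    have h2 := Real.exp_injective h1
    apply hij
    rw [h2]; norm_num
  have hz' : ∀ i j : Fin (m + 2 + 2), (i ≠ 0 ∨ j ≠ pl) → X i j = 0 := fun i j hij => by
    refine hz i j ?_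
    induction i using index_cases <;> induction j using index_cases <;> simp at hij ⊢ <;>
    norm_num
  refine ⟨⟨⟨fun i j hij => hz' i j ?_, fun i => ?_, hskew⟩, ?_, ?_, fun j => ?_, ?_⟩, ?_⟩
  · by_contra! h
    have hij' : j < i := hij
    rw [h.1, h.2] at hij'
    exact absurd hij' (not_lt.2 zero_lt_pl.le)
  · rw [hz' i i, star_zero]
    by_contra! h
    exact zero_lt_pl.ne (h.1.symm.trans h.2)
  · exact hz' _ _ (Or.inr zero_lt_pl.ne)
  · exact hz' _ _ (Or.inr one_lt_pl.ne)
  · exact hz' _ _ (Or.inr (md_lt_pl j).ne)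
  · exact hz' _ _ (Or.inr pn_lt_pl.ne)
  · rw [coord_apply, hz' _ _ (Or.inr one_lt_pl.ne), hz' _ _ (Or.inr pn_lt_pl.ne)]
    exact Prod.ext rfl (Prod.ext (funext fun j => hz' _ _ (Or.inr (md_lt_pl j).ne)) rfl)

lemma IsHeis.eq_sum_comp {v : Mat (m + 2) F} (hv : IsHeis v) :
    v = comp 1 0 v + comp 1 1 v + comp 1 2 v + comp 2 2 v := by
  have hpl : ∀ i, i ≠ 0 → v i pl = comp 1 0 v i pl + comp 1 1 v i pl + comp 1 2 v i pl +
      comp 2 2 v i pl := fun i hi => by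
    induction i using index_cases with
    | h0 => exact absurd rfl hi
    | h1 => simp [comp]; norm_num
    | hm j => simp [comp]; norm_num
    | hn => simp [comp]; norm_num
    | hl => simp [comp, hv.pl_pl']
  have hzero : ∀ j, v 0 j = comp 1 0 v 0 j + comp 1 1 v 0 j + comp 1 2 v 0 j +
      comp 2 2 v 0 j := fun j => by
    induction j using index_cases with
    | h0 => simp [comp, hv.zero_zero]
    | h1 => simp [comp]; norm_num
    | hm j => simp [comp]; norm_num
    | hn => simp [comp]; norm_num
    | hl => simp [comp]; norm_num
  ext i j
  simp only [Matrix.add_apply]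
  by_cases hi : i = 0
  · rw [hi]; exact hzero j
  by_cases hj : j = pl
  · rw [hj]; exact hpl i hi
  · simp [comp, hv.eq_zero hi hj]

lemma comp_two_two_apply (v : Mat (m + 2) F) : comp 2 2 v 0 pl = v 0 pl := by
  simp [comp]; norm_num

lemma mem_rootSpace_two_two_iff {v : Mat (m + 2) F} :
    v ∈ rootSpace (m + 2) F 2 2 ↔ IsHeis v ∧ coord v = 0 := by
  refine ⟨isHeis_of_mem_rootSpace_two_two, fun ⟨hv, hc⟩ => ?_⟩
  have h := comp_mem_rootSpace (p := 2) (q := 2) (Or.inl two_ne_zero) hv.toIsBorel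
  suffices e : v = comp 2 2 v by rw [e]; exact h
  have h1 : ∀ j, j ≠ pl → v 0 j = 0 := fun j hj => by
    induction j using index_cases with
    | h0 => exact hv.zero_zero
    | h1 => exact congrArg Prod.fst hc
    | hm j => exact congrFun (congrArg (fun p : Coord m F => p.2.1) hc) j
    | hn => exact congrArg (fun p : Coord m F => p.2.2) hc
    | hl => exact absurd rfl hj
  have hother : ∀ i j, i ≠ 0 ∨ j ≠ pl → v i j = 0 := fun i j hij => by
    by_cases hi : i = 0
    · rw [hi]; exact h1 j (hij.resolve_left (not_not.2 hi))
    by_cases hj : j = pl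
    · rw [hj, hv.skew, flip_pl, h1, star_zero, neg_zero]
      intro e
      exact hi (by rw [← flip_flip i, e, flip_pl])
    · exact hv.eq_zero hi hj
  ext i j
  by_cases hij : i ≠ 0 ∨ j ≠ pl
  · simp [comp, hother i j hij]
  · push Not at hij
    rw [hij.1, hij.2, comp_two_two_apply]

end RootSpaces

/-! ### Compatibility with `A` and the semidirect decomposition. -/

section GroupStructure

variable {m : ℕ} {F : Type*} [RCLike F]

lemma mul_apply_diag {n : ℕ} {M M' : Mat n F} (h : M.BlockTriangular id)
    (h' : M'.BlockTriangular id) (i : Fin (n + 2)) : (M * M') i i = M i i * M' i i := by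
  rw [Matrix.mul_apply, Finset.sum_eq_single i]
  · intro j _ hj
    rcases lt_or_gt_of_ne hj with hlt | hlt
    · rw [h hlt, zero_mul]
    · rw [h' hlt, mul_zero]
  · simp

lemma N_normalized {g u : SL (m + 2) F} (hG : g ∈ G (m + 2) F)
    (hg : (g : Mat (m + 2) F).BlockTriangular id)
    (hg' : ((g⁻¹ : SL (m + 2) F) : Mat (m + 2) F).BlockTriangular id) (hu : u ∈ N (m + 2) F) :
    g * u * g⁻¹ ∈ N (m + 2) F := by
  refine ⟨mul_mem (mul_mem hG (N_le_G hu)) (inv_mem hG), (hg.mul hu.2.1).mul hg', fun i => ?_⟩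
  change ((g : Mat (m + 2) F) * (u : Mat (m + 2) F) *
    ((g⁻¹ : SL (m + 2) F) : Mat (m + 2) F)) i i = 1
  have h1 : (g : Mat (m + 2) F) * ((g⁻¹ : SL (m + 2) F) : Mat (m + 2) F) = 1 :=
    congrArg Subtype.val (mul_inv_cancel g)
  rw [mul_apply_diag (hg.mul hu.2.1) hg', mul_apply_diag hg hu.2.1, hu.2.2, mul_one,
    ← mul_apply_diag hg hg', h1, Matrix.one_apply_eq]

variable {H : Subgroup (SL (m + 2) F)}

lemma blockTriangular_of_mem (hAN : (H : Set (SL (m + 2) F)) ⊆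
      (A (m + 2) F : Set _) * (N (m + 2) F : Set _)) {h : SL (m + 2) F} (hh : h ∈ H) :
    (h : Mat (m + 2) F).BlockTriangular id := by
  obtain ⟨s, t, b, hb, rfl⟩ := exists_torus_mul_of_mem hAN hh
  exact torus_mul_blockTriangular hb

lemma mem_G_of_mem (hAN : (H : Set (SL (m + 2) F)) ⊆
      (A (m + 2) F : Set _) * (N (m + 2) F : Set _)) {h : SL (m + 2) F} (hh : h ∈ H) :
    h ∈ G (m + 2) F := by
  obtain ⟨s, t, b, hb, rfl⟩ := exists_torus_mul_of_mem hAN hh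
  exact mul_mem (A_le_G (torus_mem_A s t)) (N_le_G hb)

lemma torus_mem_torusPart (hAN : (H : Set (SL (m + 2) F)) ⊆
      (A (m + 2) F : Set _) * (N (m + 2) F : Set _)) {X : Mat (m + 2) F} (hX : X ∈ lieAlg H) :
    torus F (RCLike.re (X 0 0)) (RCLike.re (X 1 1)) ∈ torusPart H := by
  obtain ⟨h, hh, -, b, hb, hbt⟩ := exists_exp_eq_torus_mul hAN hX
  exact ⟨torus_mem_A _ _, h, hh, b⁻¹, inv_mem hb, by rw [hbt]; simp⟩

/-- In a compatible group, the `A`-component of `h` lies in the group as soon as the possible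
centralizing factor is trivial. -/
lemma torus_mem_of_compatible (hcompat : CompatibleWithA H) {s t : ℝ} {b : SL (m + 2) F}
    (hb : b ∈ N (m + 2) F) (hh : torus F s t * b ∈ H)
    (htriv : ∀ u ∈ H ⊓ N (m + 2) F, ∀ c ∈ N (m + 2) F, c ∈ Subgroup.centralizer (torusPart H) →
      torus F s t * u * c = torus F s t * b → c = 1) : torus F s t ∈ H := by
  obtain ⟨_, ⟨τ, hτ, u, hu, rfl⟩, c, ⟨hcN, hcC⟩, hprod⟩ := hcompat hh
  obtain ⟨s', t', rfl⟩ := exists_torus_of_mem_A hτ.1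
  change torus F s' t' * u * c = torus F s t * b at hprod
  have huc : u * c ∈ N (m + 2) F := mul_mem hu.2 hcN
  obtain ⟨rfl, rfl⟩ : s' = s ∧ t' = t := by
    refine torus_eq_of_diag huc ?_ ?_ <;>
    rw [← mul_assoc, hprod, torus_mul_diag hb] <;> simp
  have hc1 := htriv u hu c hcN hcC hprod
  rw [← hprod, hc1, mul_one] at hh
  exact (Subgroup.mul_mem_cancel_right H hu.1).1 hh

lemma apply_eq_zero_of_commute_torus {c : SL (m + 2) F} {s t : ℝ}
    (hc : torus F s t * c = c * torus F s t) {i j : Fin (m + 2 + 2)}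
    (hij : wt s t i ≠ wt s t j) : (c : Mat (m + 2) F) i j = 0 := by
  have h : ((torus F s t : SL (m + 2) F) : Mat (m + 2) F) * (c : Mat (m + 2) F) =
      (c : Mat (m + 2) F) * ((torus F s t : SL (m + 2) F) : Mat (m + 2) F) :=
    congrArg Subtype.val hc
  have h1 := congrFun (congrFun h i) j
  rw [coe_torus, diagonal_mul, mul_diagonal, mul_comm] at h1
  by_contra hne
  exact hij (Real.exp_injective (RCLike.ofReal_injective (mul_left_cancel₀ hne h1)))

/-- If the projection of the Lie algebra to `𝔞` is onto, then the group contains `A`, and hence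
a curve along the wall. -/
lemma hasNearlyQuadraticCurve_of_diag_surjective (hAN : (H : Set (SL (m + 2) F)) ⊆
      (A (m + 2) F : Set _) * (N (m + 2) F : Set _)) (hcompat : CompatibleWithA H)
    (hsurj : ∀ s t : ℝ, ∃ X ∈ lieAlg H, RCLike.re (X 0 0) = s ∧ RCLike.re (X 1 1) = t) :
    HasNearlyQuadraticCurve H := by
  refine hasNearlyQuadraticCurve_of_torus fun t => ?_
  obtain ⟨X, hX, hX0, hX1⟩ := hsurj t t
  obtain ⟨h, hh, -, b, hb, hbt⟩ := exists_exp_eq_torus_mul hAN hX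
  rw [hX0, hX1] at hbt
  refine torus_mem_of_compatible hcompat hb (hbt ▸ hh) fun u _ c hc hcC _ => ?_
  -- The weights `2, 1, 0, -1, -2` separate all indices outside the middle block. An element of `N`
  -- commuting with this torus element is thus confined to that block, where it is the identity.
  obtain ⟨Y, hY, hY0, hY1⟩ := hsurj 2 1
  have hmem := torus_mem_torusPart hAN hY
  rw [hY0, hY1] at hmem
  have hcomm := Subgroup.mem_centralizer_iff.1 hcC _ hmem
  apply Subtype.ext
  change (c : Mat (m + 2) F) = 1
  ext i j
  by_cases hij : wt 2 1 i = wt 2 1 j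
  · induction i using index_cases <;> induction j using index_cases <;>
    simp only [wt_zero, wt_one, wt_md, wt_pn, wt_pl] at hij <;>
    first
    | (exfalso; norm_num at hij; done)
    | (rw [hc.2.2, Matrix.one_apply_eq])
    | (rw [N_md_md hc, Matrix.one_apply]; simp only [md_injective.eq_iff])
  · rw [apply_eq_zero_of_commute_torus hcomm hij, Matrix.one_apply_ne]
    rintro rfl
    exact hij rfl

/-- The middle block of the matrix is the identity. -/
def MidOne (M : Mat (m + 2) F) : Prop :=
  ∀ i j : Fin (m + 2 + 2), i ≠ 0 → i ≠ pl → j ≠ 0 → j ≠ pl → M i j = if i = j then 1 else 0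

lemma index_pos {i : Fin (m + 2 + 2)} (h : i ≠ 0) : 0 < i := Fin.pos_of_ne_zero h

lemma index_lt_pl {i : Fin (m + 2 + 2)} (h : i ≠ pl) : i < pl := by
  have h1 := i.2
  simp only [ne_eq, Fin.ext_iff, pl] at h
  simp only [Fin.lt_def, pl]
  omega

/-- Triangularity removes the terms passing through the first and last indices, so rows in the
middle range multiply as if by the middle block, here the identity. -/
lemma MidOne.mul_apply {M M' : Mat (m + 2) F} (hM : MidOne M) (hu : M.BlockTriangular id)
    (hu' : M'.BlockTriangular id) {i j : Fin (m + 2 + 2)} (hi : i ≠ 0) (hi' : i ≠ pl)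
    (hj' : j ≠ pl) : (M * M') i j = M' i j := by
  rw [Matrix.mul_apply, Finset.sum_eq_single i]
  · rw [hM i i hi hi' hi hi', if_pos rfl, one_mul]
  · intro k _ hk
    by_cases hk0 : k = 0
    · rw [hk0, hu (index_pos hi), zero_mul]
    by_cases hkl : k = pl
    · rw [hkl, show M' pl j = 0 from hu' (index_lt_pl hj'), mul_zero]
    · rw [hM i k hi hi' hk0 hkl, if_neg hk.symm, zero_mul]
  · simp

/-- The elements of an upper triangular group whose middle block is the identity. -/
def midOneSubgroup (H : Subgroup (SL (m + 2) F))
    (hH : ∀ h ∈ H, (h : Mat (m + 2) F).BlockTriangular id) : Subgroup (SL (m + 2) F) where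
  carrier := {h | h ∈ H ∧ MidOne (h : Mat (m + 2) F)}
  one_mem' := ⟨one_mem H, fun _ _ _ _ _ _ => Matrix.one_apply⟩
  mul_mem' := by
    rintro a b ⟨ha, ha'⟩ ⟨hb, hb'⟩
    refine ⟨mul_mem ha hb, fun i j hi hi' hj hj' => ?_⟩
    exact (ha'.mul_apply (hH a ha) (hH b hb) hi hi' hj').trans (hb' i j hi hi' hj hj')
  inv_mem' := by
    rintro a ⟨ha, ha'⟩
    refine ⟨inv_mem ha, fun i j hi hi' hj hj' => ?_⟩
    have h1 : (a : Mat (m + 2) F) * ((a⁻¹ : SL (m + 2) F) : Mat (m + 2) F) = 1 :=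
      congrArg Subtype.val (mul_inv_cancel a)
    rw [← ha'.mul_apply (hH a ha) (hH _ (inv_mem ha)) hi hi' hj', h1, Matrix.one_apply]

lemma IsBorel.mid_eq_zero {X : Mat (m + 2) F} (h : IsBorel X) (h11 : X 1 1 = 0)
    (hy : ∀ j, X 1 (md j) = 0) (hz : X 1 pn = 0) {i j : Fin (m + 2 + 2)} (hi : i ≠ 0)
    (hi' : i ≠ pl) (hj : j ≠ pl) : X i j = 0 := by
  by_cases hj0 : j = 0
  · rw [hj0]; exact h.eq_zero_of_lt (index_pos hi)
  induction i using index_cases with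
  | h0 => exact absurd rfl hi
  | h1 => induction j using index_cases with
    | h0 => exact absurd rfl hj0
    | h1 => exact h11
    | hm j => exact hy j
    | hn => exact hz
    | hl => exact absurd rfl hj
  | hm i => induction j using index_cases with
    | h0 => exact absurd rfl hj0
    | h1 => exact h.md_one i
    | hm j => exact h.md_md i j
    | hn => rw [h.md_pn, hy, star_zero, neg_zero]
    | hl => exact absurd rfl hj
  | hn => induction j using index_cases with
    | h0 => exact absurd rfl hj0
    | h1 => exact h.pn_one
    | hm j => exact h.pn_md j
    | hn => rw [h.pn_pn, h11, neg_zero]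
    | hl => exact absurd rfl hj
  | hl => exact absurd rfl hi'

/-- The middle block of `X` is zero, and by triangularity so is that of every positive power; only
the constant term of the series remains. -/
lemma midOne_exp {X : Mat (m + 2) F} (h : IsBorel X) (h11 : X 1 1 = 0)
    (hy : ∀ j, X 1 (md j) = 0) (hz : X 1 pn = 0) : MidOne (NormedSpace.exp X) := by
  have hpow : ∀ k : ℕ, (X ^ k).BlockTriangular id := fun k => by
    induction k with
    | zero => simpa using blockTriangular_one
    | succ k ih => rw [pow_succ]; exact ih.mul h.upper
  intro i j hi hi' hj hj'
  have hs := hasSum_exp_entry X i j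
  have h2 := hasSum_single (f := fun k : ℕ => ((k.factorial : ℝ)⁻¹) • (X ^ k) i j) 0 (by
    intro k hk
    obtain ⟨l, rfl⟩ := Nat.exists_eq_succ_of_ne_zero hk
    have : (X ^ (l + 1)) i j = 0 := by
      rw [pow_succ', Matrix.mul_apply]
      refine Finset.sum_eq_zero fun k _ => ?_
      by_cases hkl : k = pl
      · rw [hkl, show (X ^ l) pl j = 0 from hpow l (index_lt_pl hj'), mul_zero]
      · rw [h.mid_eq_zero h11 hy hz hi hi' hkl, zero_mul]
    simp [this])
  rw [hs.unique h2]
  simp [Matrix.one_apply]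

lemma midOne_of_mem (hAN : (H : Set (SL (m + 2) F)) ⊆
      (A (m + 2) F : Set _) * (N (m + 2) F : Set _)) (hcl : IsClosed (H : Set (SL (m + 2) F)))
    (hconn : IsConnected (H : Set (SL (m + 2) F)))
    (hmid : ∀ X ∈ lieAlg H, X 1 1 = 0 ∧ (∀ j, X 1 (md j) = 0) ∧ X 1 pn = 0)
    {h : SL (m + 2) F} (hh : h ∈ H) : MidOne (h : Mat (m + 2) F) := by
  have hle : H ≤ midOneSubgroup H fun _ hg => blockTriangular_of_mem hAN hg := by
    refine le_of_exp_mem hcl hconn fun X hX g hg he => ⟨hg, ?_⟩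
    obtain ⟨h1, h2, h3⟩ := hmid X hX
    rw [he]
    exact midOne_exp (isBorel_of_mem_lieAlg hAN hX) h1 h2 h3
  exact (hle hh).2

lemma mem_kerβ_iff {a : SL (m + 2) F} : a ∈ kerβ (m + 2) F ↔ ∃ s : ℝ, a = torus F s 0 := by
  constructor
  · rintro ⟨ha, hβ⟩
    obtain ⟨s, t, rfl⟩ := exists_torus_of_mem_A ha
    rw [rootβ_torus] at hβ
    have : Real.exp t = 1 := by exact_mod_cast hβ
    rw [Real.exp_eq_one_iff] at this
    exact ⟨s, by rw [this]⟩
  · rintro ⟨s, rfl⟩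
    exact ⟨torus_mem_A s 0, by rw [rootβ_torus]; simp⟩

/-- Compatibility writes an element over `torus s 0` as `torus s 0 * u * c`. Commuting with `torus 1
0` kills the off-diagonal entries of `c` in the first row and last column, and the middle block of
`c` is the identity because those of the other factors and of the product are. Hence `c = 1`. -/
lemma kerβ_le (hAN : (H : Set (SL (m + 2) F)) ⊆
      (A (m + 2) F : Set _) * (N (m + 2) F : Set _)) (hcompat : CompatibleWithA H)
    (hmid : ∀ h ∈ H, MidOne (h : Mat (m + 2) F))
    (hsurj : ∀ s : ℝ, ∃ X ∈ lieAlg H, RCLike.re (X 0 0) = s ∧ RCLike.re (X 1 1) = 0) :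
    kerβ (m + 2) F ≤ H := by
  intro a ha
  obtain ⟨s, rfl⟩ := mem_kerβ_iff.1 ha
  obtain ⟨X, hX, hX0, hX1⟩ := hsurj s
  obtain ⟨h, hh, -, b, hb, hbt⟩ := exists_exp_eq_torus_mul hAN hX
  rw [hX0, hX1] at hbt
  refine torus_mem_of_compatible hcompat hb (hbt ▸ hh) fun u hu c hc hcC hprod => ?_
  obtain ⟨Y, hY, hY0, hY1⟩ := hsurj 1
  have hmem := torus_mem_torusPart hAN hY
  rw [hY0, hY1] at hmem
  have hcomm := Subgroup.mem_centralizer_iff.1 hcC _ hmem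
  have htor : MidOne ((torus F s 0 : SL (m + 2) F) : Mat (m + 2) F) := by
    intro i j hi hi' hj hj'
    rw [coe_torus, diagonal_apply]
    split_ifs with hij
    · induction i using index_cases <;> simp at hi hi' ⊢
    · rfl
  have hcmid : MidOne (c : Mat (m + 2) F) := by
    intro i j hi hi' hj hj'
    have h1 : ((torus F s 0 : SL (m + 2) F) : Mat (m + 2) F) *
        ((u : Mat (m + 2) F) * (c : Mat (m + 2) F)) = (h : Mat (m + 2) F) := by
      rw [← Matrix.mul_assoc, hbt]
      exact congrArg Subtype.val hprod
    rw [← (hmid u hu.1).mul_apply hu.2.2.1 hc.2.1 hi hi' hj',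
      ← htor.mul_apply (torus_blockTriangular s 0) (hu.2.2.1.mul hc.2.1) hi hi' hj', h1]
    exact hmid h hh i j hi hi' hj hj'
  have hwl : ∀ i : Fin (m + 2 + 2), i ≠ pl → wt 1 0 i ≠ wt 1 0 (pl : Fin (m + 2 + 2)) := by
    intro i hi
    induction i using index_cases <;> simp at hi ⊢ <;> norm_num
  have hw0 : ∀ i : Fin (m + 2 + 2), i ≠ 0 → wt 1 0 (0 : Fin (m + 2 + 2)) ≠ wt 1 0 i := by
    intro i hi
    induction i using index_cases <;> simp at hi ⊢ <;> norm_num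
  apply Subtype.ext
  change (c : Mat (m + 2) F) = 1
  ext i j
  rw [Matrix.one_apply]
  by_cases hij : i = j
  · rw [hij, hc.2.2, if_pos rfl]
  rw [if_neg hij]
  by_cases hi : i = 0
  · subst hi
    exact apply_eq_zero_of_commute_torus hcomm (hw0 j (Ne.symm hij))
  by_cases hj : j = pl
  · subst hj
    exact apply_eq_zero_of_commute_torus hcomm (hwl i hij)
  by_cases hi' : i = pl
  · subst hi'
    exact hc.2.1 (index_lt_pl hj)
  by_cases hj' : j = 0
  · subst hj'
    exact hc.2.1 (index_pos hi)
  rw [hcmid i j hi hi' hj' hj, if_neg hij]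

lemma isSemidirect_kerβ (hAN : (H : Set (SL (m + 2) F)) ⊆
      (A (m + 2) F : Set _) * (N (m + 2) F : Set _))
    (hmid : ∀ h ∈ H, MidOne (h : Mat (m + 2) F)) (hker : kerβ (m + 2) F ≤ H) :
    IsSemidirect H (kerβ (m + 2) F) (H ⊓ N (m + 2) F) := by
  refine ⟨hker, inf_le_left, ⟨fun u hu g => ?_⟩, ?_, ?_⟩
  · rw [Subgroup.mem_subgroupOf] at hu ⊢
    refine ⟨(g * u * g⁻¹).2, ?_⟩
    exact N_normalized (mem_G_of_mem hAN g.2) (blockTriangular_of_mem hAN g.2)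
      (blockTriangular_of_mem hAN (inv_mem g.2)) hu.2
  · rw [eq_bot_iff]
    rintro a ⟨ha, hu⟩
    obtain ⟨s, rfl⟩ := mem_kerβ_iff.1 ha
    have h0 : ((torus F s 0 : SL (m + 2) F) : Mat (m + 2) F) 0 0 = 1 := hu.2.2.2 0
    rw [coe_torus, diagonal_apply_eq, wt_zero] at h0
    have : Real.exp s = 1 := by exact_mod_cast h0
    rw [Real.exp_eq_one_iff] at this
    rw [this, torus_zero]
    exact one_mem _
  · ext h
    constructor
    · intro hh
      obtain ⟨s, t, b, hb, rfl⟩ := exists_torus_mul_of_mem hAN hh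
      have h1 := hmid _ hh 1 1 zero_lt_one_index.ne' one_lt_pl.ne zero_lt_one_index.ne' one_lt_pl.ne
      rw [torus_mul_diag hb, if_pos rfl, wt_one] at h1
      have ht : Real.exp t = 1 := by exact_mod_cast h1
      rw [Real.exp_eq_one_iff] at ht
      subst ht
      have hk : torus F s 0 ∈ kerβ (m + 2) F := mem_kerβ_iff.2 ⟨s, rfl⟩
      exact ⟨_, hk, b, ⟨(Subgroup.mul_mem_cancel_left H (hker hk)).1 hh, hb⟩, rfl⟩
    · rintro ⟨a, ha, u, hu, rfl⟩
      exact mul_mem (hker ha) hu.1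

end GroupStructure

end SU2

/-! ### Assembly of the main theorem. -/

theorem mainTheorem9 {F : Type*} [RCLike F] (n : ℕ) (hn : 3 ≤ n)
    (H : Subgroup (SU2.SL n F))
    (hAN : (H : Set (SU2.SL n F)) ⊆
      (SU2.A n F : Set _) * (SU2.N n F : Set _))
    (hclosed : IsClosed (H : Set (SU2.SL n F)))
    (hconn : IsConnected (H : Set (SU2.SL n F)))
    (hcompat : SU2.CompatibleWithA H)
    (hcurve : ¬ SU2.HasNearlyQuadraticCurve H) :
    SU2.dim H ≤ Module.finrank ℝ F * n ∧
    (SU2.dim H = Module.finrank ℝ F * n →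
      SU2.IsSemidirect H (SU2.kerβ n F) (H ⊓ SU2.N n F) ∧
      SU2.lieAlg (H ⊓ SU2.N n F) =
        (((SU2.rootSpace n F 1 0 ⊔ SU2.rootSpace n F 1 1 ⊔ SU2.rootSpace n F 1 2 :
            Submodule ℝ (SU2.Mat n F)) : Set _) ∩
          SU2.lieAlg (H ⊓ SU2.N n F)) + (SU2.rootSpace n F 2 2 : Set _) ∧
      ∀ u ∈ SU2.lieAlg (H ⊓ SU2.N n F), u ∉ SU2.rootSpace n F 2 2 →
        SU2.normSqX u +
          2 * RCLike.re (SU2.coordφ u * starRingEnd F (SU2.coordη u)) ≠ 0) := by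
  obtain ⟨m, rfl⟩ : ∃ m, n = m + 2 := ⟨n - 2, by omega⟩
  open SU2 in
  set L := lieSub H hclosed with hLdef
  have hL : ∀ X ∈ L, IsBorel X := fun X hX => isBorel_of_mem_lieAlg hAN hX
  have hbr : ∀ X ∈ L, ∀ Y ∈ L, X * Y - Y * X ∈ L := fun X hX Y hY => bracket_mem_lieSub hX hY
  have han : IsAnisotropic L := fun v hv hh hQ => by
    by_contra h0
    exact hcurve (hasNearlyQuadraticCurve_of_isHeis hv hh hQ h0)
  have hdiag : Module.finrank ℝ (L.map diagPart) ≤ 1 := by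
    by_contra hlt
    apply hcurve
    have htop : L.map diagPart = ⊤ := by
      refine Submodule.eq_top_of_finrank_eq (le_antisymm (Submodule.finrank_le _) ?_)
      rw [Module.finrank_prod, Module.finrank_self]
      omega
    refine hasNearlyQuadraticCurve_of_diag_surjective hAN hcompat fun s t => ?_
    obtain ⟨X, hX, hXst⟩ : ((s, t) : ℝ × ℝ) ∈ L.map diagPart := by rw [htop]; trivial
    exact ⟨X, hX, congrArg Prod.fst hXst, congrArg Prod.snd hXst⟩
  rw [dim_eq_finrank_lieSub H hclosed]
  refine ⟨finrank_le_of_diagPart_le hL hbr han hdiag, fun heq => ?_⟩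
  obtain ⟨hheis, ⟨X, hX, hX0⟩, hmidL, himag⟩ := structure_of_finrank_eq hL hbr han hdiag heq
  have hmid : ∀ h ∈ H, MidOne (h : Mat (m + 2) F) := fun h hh =>
    midOne_of_mem hAN hclosed hconn hmidL hh
  have hsurj : ∀ s : ℝ, ∃ X ∈ lieAlg H, RCLike.re (X 0 0) = s ∧ RCLike.re (X 1 1) = 0 := by
    intro s
    have h11 : RCLike.re (X 1 1) = 0 := by rw [(hmidL X hX).1, map_zero]
    -- The `(1, 1)` entry vanishes, so the nonzero diagonal part must come from `(0, 0)`; rescaling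
    -- then reaches every `s`.
    have h00 : RCLike.re (X 0 0) ≠ 0 := fun h => hX0 (Prod.ext h h11)
    refine ⟨(s / RCLike.re (X 0 0)) • X, L.smul_mem _ hX, ?_, ?_⟩
    · rw [Matrix.smul_apply, RCLike.smul_re, div_mul_cancel₀ _ h00]
    · rw [Matrix.smul_apply, RCLike.smul_re, h11, mul_zero]
  have hker := kerβ_le hAN hcompat hmid hsurj
  have hU : ∀ {v}, v ∈ lieAlg (H ⊓ N (m + 2) F) ↔ v ∈ nilPart L := fun {v} => by
    rw [mem_lieAlg_inf_N hAN, mem_nilPart hL]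
    rfl
  -- An element of `𝔫_{2α+2β}` is determined by its imaginary corner entry, and in the case of
  -- equality `L` realizes every imaginary corner.
  have h22 : ∀ v ∈ rootSpace (m + 2) F 2 2, v ∈ nilPart L := by
    intro v hv
    obtain ⟨hvh, hvc⟩ := isHeis_of_mem_rootSpace_two_two hv
    obtain ⟨w, hw, hwh, hwc, hwz⟩ := himag (v 0 pl) (mem_imag_of_star_eq_neg hvh.star_zero_pl)
    have hw2 := mem_rootSpace_two_two_iff.2 ⟨hwh, hwc⟩
    obtain ⟨hdh, hdc⟩ := isHeis_of_mem_rootSpace_two_two ((rootSpace (m + 2) F 2 2).sub_mem hv hw2)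
    have hd := hdh.eq_zero_of_coord_eq_zero hdc (by rw [Matrix.sub_apply, hwz, sub_self])
    rw [sub_eq_zero.1 hd]
    exact (mem_nilPart hL).2 ⟨hw, hwh.zero_zero, hwh.one_one⟩
  refine ⟨isSemidirect_kerβ hAN hmid hker, ?_, ?_⟩
  · apply Set.Subset.antisymm
    · intro v hv
      have hvh := hheis v (hU.1 hv)
      have h2 := comp_mem_rootSpace (p := 2) (q := 2) (Or.inl two_ne_zero) hvh.toIsBorel
      have hsum := hvh.eq_sum_comp
      have hsub : v - comp 2 2 v = comp 1 0 v + comp 1 1 v + comp 1 2 v := by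
        rw [sub_eq_iff_eq_add]; exact hsum
      refine ⟨v - comp 2 2 v, ⟨?_, hU.2 ((nilPart L).sub_mem (hU.1 hv) (h22 _ h2))⟩, comp 2 2 v,
        h2, sub_add_cancel _ _⟩
      rw [hsub]
      exact Submodule.add_mem_sup (Submodule.add_mem_sup
        (comp_mem_rootSpace (Or.inl one_ne_zero) hvh.toIsBorel)
        (comp_mem_rootSpace (Or.inl one_ne_zero) hvh.toIsBorel))
        (comp_mem_rootSpace (Or.inl one_ne_zero) hvh.toIsBorel)
    · rintro _ ⟨v, ⟨-, hv⟩, w, hw, rfl⟩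
      exact hU.2 ((nilPart L).add_mem (hU.1 hv) (h22 w hw))
  · intro v hv hv2
    have hvh := hheis v (hU.1 hv)
    rw [normSqX_add_eq_form]
    intro h0
    exact hv2 (mem_rootSpace_two_two_iff.2 ⟨hvh, han v (hU.1 hv).1 hvh h0⟩)
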